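/- Let $p$ be a natural number and let $\mathbb S^p_+$ and $\mathbb S^p_{++}$ be the sets of positive semidefinite and positive definite real $p\times p$ matrices. Let $\|X\|_F=\sqrt{\mathrm{Tr}(X^\top X)}$ be the Frobenius norm, and let $O(p)$ be the orthogonal group. For $x\in\mathbb R^p$ let $x^\uparrow$ be the vector of its entries in non-decreasing order. Consider the following functions $D:\mathbb S^p_+\times\mathbb S^p_+\to(-\infty,+\infty]$ and functions $d:\mathbb R_+\times\mathbb R_+\to(-\infty,+\infty]$. Each formula holds on the indicated domain of $D$, and on the corresponding domain of $d$ (obtained by replacing $\mathbb S^p_+,\mathbb S^p_{++}$ by $[0,\infty),(0,\infty)$). The value is $+\infty$ elsewhere. 1. Kullback–Leibler, on $\mathbb S^p_{++}\times\mathbb S^p_{++}$: $D(X,S)=\frac12\big(\mathrm{Tr}(S^{-1}X)-p+\log\det(SX^{-1})\big)$, $d(a,b)=\frac12\big(\frac ab-1-\log\frac ab\big)$. 2. Wasserstein, on $\mathbb S^p_+\times\mathbb S^p_+$: $D(X,S)=\mathrm{Tr}\big(X+S-2(X^{1/2}SX^{1/2})^{1/2}\big)$, $d(a,b)=a+b-2\sqrt{ab}$.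 3. Symmetrized Stein, on $\mathbb S^p_{++}\times\mathbb S^p_{++}$: $D(X,S)=\frac12\big(\mathrm{Tr}(S^{-1}X)+\mathrm{Tr}(X^{-1}S)-2p\big)$, $d(a,b)=\frac12\big(\frac ba+\frac ab-2\big)$. 4. Squared Frobenius, on $\mathbb S^p_+\times\mathbb S^p_+$: $D(X,S)=\mathrm{Tr}\big((X-S)^2\big)$, $d(a,b)=(a-b)^2$. 5. Weighted Frobenius, on $\mathbb S^p_+\times\mathbb S^p_{++}$: $D(X,S)=\mathrm{Tr}\big((X-S)^2S^{-1}\big)$, $d(a,b)=\frac{(a-b)^2}{b}$. **Proposition.** Each of these five divergences $D$, with its $d$, has the following properties. *Convexity and coercivity.* - $D\ge 0$, and whenever $D(X,Y)<\infty$, $D(X,Y)=0$ if and only if $X=Y$. - For every $S\in\mathbb S^p_+$ the function $D(\cdot,S)$ on $\mathbb S^p_+$ is convex and is continuous as an extended-real-valued function. It is differentiable (as a function of a symmetric matrix) on the interior of its domain, that is, at every $X\in\mathbb S^p_{++}$ with $D(X,S)<\infty$. For the squared Frobenius divergence with $S\in\mathbb S^p_+$ and the weighted Frobenius divergence with $S\in\mathbb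 S^p_{++}$, it is differentiable relative to $\mathbb S^p_+$ at every $X\in\mathbb S^p_+$. - For every $S\in\mathbb S^p_+$, $D(X,S)\to+\infty$ as $\|X\|_F\to\infty$, $X\in\mathbb S^p_+$. *Spectral properties.* - (Orthogonal equivariance) $D(X,Y)=D(VXV^\top,VYV^\top)$ for all $X,Y\in\mathbb S^p_+$ and $V\in O(p)$. - (Spectral generator) $d\ge0$ and $D(\mathrm{diag}(x),\mathrm{diag}(y))=\sum_{i=1}^p d(x_i,y_i)$ for all $x,y\in\mathbb R^p_+$. For every $b\ge0$, $d(\cdot,b)$ is twice continuously differentiable on the interior of its domain $\{a\ge 0: d(a,b)<\infty\}$. For the squared Frobenius divergence with $b\ge0$ and the weighted Frobenius divergence with $b>0$, it is twice continuously differentiable on all of $[0,\infty)$. - (Rearrangement inequality) For all $x,y\in\mathbb R^p_+$ and $V\in O(p)$, $$D(V\mathrm{diag}(x^\uparrow)V^\top,\mathrm{diag}(y^\uparrow))\ \ge\ D(\mathrm{diag}(x^\uparrow),\mathrm{diag}(y^\uparrow)).$$ - (Equality case) If the left side is finite, equality holds if and only if there is $W\in O(p)$ with $W\mathrm{diag}(y^\uparrow)W^\top=\mathrm{diag}(y^\uparrow)$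 and $V\mathrm{diag}(x^\uparrow)V^\top=W\mathrm{diag}(x^\uparrow)W^\top$. In particular, if the entries of $y$ are pairwise distinct, equality holds if and only if $V\mathrm{diag}(x^\uparrow)V^\top=\mathrm{diag}(x^\uparrow)$. -/

import Mathlib

open scoped MatrixOrder

/-! Divergences are functions `D : Matrix → Matrix → EReal`, read on pairs of positive semidefinite
matrices; the value `⊤` marks the pairs outside the domain `dom D = {D < ⊤}`. -/

noncomputable section

/-- The Frobenius norm `√(Tr (Xᵀ X))`. -/
def frobNorm {p : ℕ} (X : Matrix (Fin p) (Fin p) ℝ) : ℝ :=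
  Real.sqrt (Matrix.trace (X.transpose * X))

/-- `x↑`: the entries of `x` rearranged in non-decreasing order. -/
def increasing {p : ℕ} (x : Fin p → ℝ) : Fin p → ℝ :=
  x ∘ Tuple.sort x

/-- Convex divergence: the function is nonnegative with the identity of indiscernibles, and for every
positive semidefinite `S` the function `D(·, S)` on the cone of positive semidefinite matrices is
convex, continuous (as an extended-real-valued function), differentiable in the interior of its domain,
and coercive. -/
structure IsConvexDivergence {p : ℕ}
    (D : Matrix (Fin p) (Fin p) ℝ → Matrix (Fin p) (Fin p) ℝ → EReal) : Prop where
  nonneg : ∀ X Y : Matrix (Fin p) (Fin p) ℝ, X.PosSemidef → Y.PosSemidef → 0 ≤ D X Y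
  eq_zero_iff : ∀ X Y : Matrix (Fin p) (Fin p) ℝ, X.PosSemidef → Y.PosSemidef →
    D X Y < ⊤ → (D X Y = 0 ↔ X = Y)
  convex : ∀ S : Matrix (Fin p) (Fin p) ℝ, S.PosSemidef →
    ∀ X Y : Matrix (Fin p) (Fin p) ℝ, X.PosSemidef → Y.PosSemidef →
    ∀ t : ℝ, 0 ≤ t → t ≤ 1 →
      D (t • X + (1 - t) • Y) S ≤ (t : EReal) * D X S + ((1 - t : ℝ) : EReal) * D Y S
  continuous : ∀ S : Matrix (Fin p) (Fin p) ℝ, S.PosSemidef →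
    ContinuousOn (fun X => D X S) {X | X.PosSemidef}
  /-- The positive definite matrices form the interior of the cone in the space of symmetric
  matrices; differentiability within this set is differentiability on symmetric matrices. -/
  differentiable : ∀ S : Matrix (Fin p) (Fin p) ℝ, S.PosSemidef →
    DifferentiableOn ℝ (fun X => (D X S).toReal) {X | X.PosDef ∧ D X S < ⊤}
  coercive : ∀ S : Matrix (Fin p) (Fin p) ℝ, S.PosSemidef →
    Filter.Tendsto (fun X => D X S)
      (Filter.comap frobNorm Filter.atTop ⊓ Filter.principal {X | X.PosSemidef})
      (nhds ⊤)

/-- Spectral divergence with generator `d : ℝ₊ × ℝ₊ → [0, ∞]`. -/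
structure IsSpectralDivergence {p : ℕ}
    (D : Matrix (Fin p) (Fin p) ℝ → Matrix (Fin p) (Fin p) ℝ → EReal)
    (d : ℝ → ℝ → EReal) : Prop where
  orthogonal_equivariance : ∀ X Y : Matrix (Fin p) (Fin p) ℝ, X.PosSemidef → Y.PosSemidef →
    ∀ V ∈ Matrix.orthogonalGroup (Fin p) ℝ,
      D X Y = D (V * X * V.transpose) (V * Y * V.transpose)
  generator_nonneg : ∀ a b : ℝ, 0 ≤ a → 0 ≤ b → 0 ≤ d a b
  spectrality : ∀ x y : Fin p → ℝ, (∀ i, 0 ≤ x i) → (∀ i, 0 ≤ y i) →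
    D (Matrix.diagonal x) (Matrix.diagonal y) = ∑ i, d (x i) (y i)
  generator_contDiff : ∀ b : ℝ, 0 ≤ b →
    ContDiffOn ℝ 2 (fun a => (d a b).toReal) (interior {a | 0 ≤ a ∧ d a b < ⊤})
  rearrangement : ∀ x y : Fin p → ℝ, (∀ i, 0 ≤ x i) → (∀ i, 0 ≤ y i) →
    ∀ V ∈ Matrix.orthogonalGroup (Fin p) ℝ,
      D (Matrix.diagonal (increasing x)) (Matrix.diagonal (increasing y)) ≤
        D (V * Matrix.diagonal (increasing x) * V.transpose) (Matrix.diagonal (increasing y))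
  /-- Equality holds exactly when `V diag(x↑) Vᵀ` and `diag(y↑)` are carried to `diag(x↑)` and
  `diag(y↑)` by one orthogonal change of basis. -/
  rearrangement_eq_iff : ∀ x y : Fin p → ℝ, (∀ i, 0 ≤ x i) → (∀ i, 0 ≤ y i) →
    ∀ V ∈ Matrix.orthogonalGroup (Fin p) ℝ,
      D (V * Matrix.diagonal (increasing x) * V.transpose) (Matrix.diagonal (increasing y)) < ⊤ →
      (D (V * Matrix.diagonal (increasing x) * V.transpose) (Matrix.diagonal (increasing y)) =
          D (Matrix.diagonal (increasing x)) (Matrix.diagonal (increasing y)) ↔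
        ∃ W ∈ Matrix.orthogonalGroup (Fin p) ℝ,
          W * Matrix.diagonal (increasing y) * W.transpose = Matrix.diagonal (increasing y) ∧
          V * Matrix.diagonal (increasing x) * V.transpose =
            W * Matrix.diagonal (increasing x) * W.transpose)
  /-- If the entries of `y` are distinct, equality forces `V diag(x↑) Vᵀ = diag(x↑)`. -/
  rearrangement_eq_iff_of_injective : ∀ x y : Fin p → ℝ, (∀ i, 0 ≤ x i) → (∀ i, 0 ≤ y i) →
    Function.Injective y →
    ∀ V ∈ Matrix.orthogonalGroup (Fin p) ℝ,
      D (V * Matrix.diagonal (increasing x) * V.transpose) (Matrix.diagonal (increasing y)) < ⊤ →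
      (D (V * Matrix.diagonal (increasing x) * V.transpose) (Matrix.diagonal (increasing y)) =
          D (Matrix.diagonal (increasing x)) (Matrix.diagonal (increasing y)) ↔
        V * Matrix.diagonal (increasing x) * V.transpose = Matrix.diagonal (increasing x))

open Classical in
/-- Kullback-Leibler divergence. -/
def klDivergence {p : ℕ} (X Y : Matrix (Fin p) (Fin p) ℝ) : EReal :=
  if X.PosDef ∧ Y.PosDef then
    (((1 / 2 : ℝ) * ((Y⁻¹ * X).trace - (p : ℝ) + Real.log (Y * X⁻¹).det) : ℝ) : EReal)
  else ⊤

open Classical in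
def klGenerator (a b : ℝ) : EReal :=
  if 0 < a ∧ 0 < b then (((1 / 2 : ℝ) * (a / b - 1 - Real.log (a / b)) : ℝ) : EReal) else ⊤

open Classical in
/-- Wasserstein divergence; `CFC.sqrt` is the positive semidefinite square root. -/
def wassersteinDivergence {p : ℕ} (X Y : Matrix (Fin p) (Fin p) ℝ) : EReal :=
  if X.PosSemidef ∧ Y.PosSemidef then
    (((X + Y - (2 : ℝ) • CFC.sqrt (CFC.sqrt X * Y * CFC.sqrt X)).trace : ℝ) : EReal)
  else ⊤

open Classical in
def wassersteinGenerator (a b : ℝ) : EReal :=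
  if 0 ≤ a ∧ 0 ≤ b then ((a + b - 2 * Real.sqrt (a * b) : ℝ) : EReal) else ⊤

open Classical in
/-- Symmetrized Stein divergence. -/
def steinDivergence {p : ℕ} (X Y : Matrix (Fin p) (Fin p) ℝ) : EReal :=
  if X.PosDef ∧ Y.PosDef then
    (((1 / 2 : ℝ) * ((Y⁻¹ * X).trace + (X⁻¹ * Y).trace - 2 * (p : ℝ)) : ℝ) : EReal)
  else ⊤

open Classical in
def steinGenerator (a b : ℝ) : EReal :=
  if 0 < a ∧ 0 < b then (((1 / 2 : ℝ) * (b / a + a / b - 2) : ℝ) : EReal) else ⊤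

open Classical in
/-- Squared Frobenius divergence. -/
def sqFrobeniusDivergence {p : ℕ} (X Y : Matrix (Fin p) (Fin p) ℝ) : EReal :=
  if X.PosSemidef ∧ Y.PosSemidef then ((((X - Y) ^ 2).trace : ℝ) : EReal) else ⊤

open Classical in
def sqFrobeniusGenerator (a b : ℝ) : EReal :=
  if 0 ≤ a ∧ 0 ≤ b then (((a - b) ^ 2 : ℝ) : EReal) else ⊤

open Classical in
/-- Weighted Frobenius divergence. -/
def weightedFrobeniusDivergence {p : ℕ} (X Y : Matrix (Fin p) (Fin p) ℝ) : EReal :=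
  if X.PosSemidef ∧ Y.PosDef then ((((X - Y) ^ 2 * Y⁻¹).trace : ℝ) : EReal) else ⊤

open Classical in
def weightedFrobeniusGenerator (a b : ℝ) : EReal :=
  if 0 ≤ a ∧ 0 < b then (((a - b) ^ 2 / b : ℝ) : EReal) else ⊤

end

/-! Every divergence here is real exactly on a product of two orthogonally invariant convex sets and
`⊤` elsewhere. `isConvexDivergence_of` and `isSpectralDivergence_of` settle the infinite values
once, leaving statements about real functions.

The spectral part rests on von Neumann's trace inequality. For orthogonal `V` the squares `V i j ^
2` form a doubly stochastic matrix, so Birkhoff's theorem and the rearrangement inequality bound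
Tr(diag y · V diag x Vᵀ) by Σ yᵢxᵢ for increasing `x`, `y`; `trace_diagonal_mul_conj_eq_iff` shows
that equality forces a common sorted eigenbasis. In the Kullback–Leibler and both Frobenius cases
`V` enters only through one such trace, with y⁻¹ in place of y or x² in place of x where needed; in
the Stein case through two.

For Wasserstein the coupling term is the nuclear norm of √Y√X, which equals Tr(Q√Y√X) for some
orthogonal Q. Then D is the squared Frobenius norm of √X Q − √Y, which gives nonnegativity and the
zero set. The excess of D over its sorted value is at least the von Neumann deficit of √x and √y, so
the inequality and its equality case follow together.

Convexity comes from Peierls' inequality: X ↦ Tr f(X) is convex when f is. It applies to S^{-1/2} X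
S^{-1/2} for Kullback–Leibler and Stein, and to −√ of √S X √S for Wasserstein. The Frobenius
divergences are quadratic with a nonnegative weight. Continuity at singular X, where
Kullback–Leibler and Stein become infinite, follows from the barrier −½ log det X. Wasserstein
differentiability follows from invertibility of the derivative of squaring at a positive definite
matrix. -/

open Matrix

/-! ### Orthogonal conjugation and doubly stochastic matrices. -/

section Orthogonal

variable {n : Type*}

lemma isHermitian_iff_transpose {A : Matrix n n ℝ} : A.IsHermitian ↔ Aᵀ = A := by
  rw [IsHermitian, conjTranspose_eq_transpose_of_trivial]

lemma eq_of_trace_sub_mul_sub_eq_zero [Fintype n] {A B : Matrix n n ℝ} (hA : A.IsHermitian)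
    (hB : B.IsHermitian) (h : ((A - B) * (A - B)).trace = 0) : A = B := by
  have h1 : (A - B)ᴴ = A - B := hA.sub hB
  rw [← sub_eq_zero, ← trace_conjTranspose_mul_self_eq_zero_iff, h1, h]

lemma diagonal_add_eq [DecidableEq n] (x y : n → ℝ) :
    diagonal (x + y) = diagonal x + diagonal y :=
  (diagonal_add x y).symm

lemma isHermitian_conj [Fintype n] {A : Matrix n n ℝ} (hA : A.IsHermitian) (V : Matrix n n ℝ) :
    (V * A * Vᵀ).IsHermitian := by
  rw [isHermitian_iff_transpose] at *
  simp [transpose_mul, hA, Matrix.mul_assoc]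

variable [Fintype n] [DecidableEq n] {V : Matrix n n ℝ}

lemma mem_orthogonalGroup_iff_transpose_mul : V ∈ orthogonalGroup n ℝ ↔ Vᵀ * V = 1 := by
  rw [mem_orthogonalGroup_iff']

lemma mem_orthogonalGroup_iff_mul_transpose : V ∈ orthogonalGroup n ℝ ↔ V * Vᵀ = 1 := by
  rw [mem_orthogonalGroup_iff]

lemma orthogonal_transpose_mul (hV : V ∈ orthogonalGroup n ℝ) : Vᵀ * V = 1 :=
  mem_orthogonalGroup_iff_transpose_mul.1 hV

lemma orthogonal_mul_transpose (hV : V ∈ orthogonalGroup n ℝ) : V * Vᵀ = 1 :=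
  mem_orthogonalGroup_iff_mul_transpose.1 hV

lemma orthogonal_transpose_mem (hV : V ∈ orthogonalGroup n ℝ) : Vᵀ ∈ orthogonalGroup n ℝ := by
  rw [mem_orthogonalGroup_iff_transpose_mul, transpose_transpose, orthogonal_mul_transpose hV]

lemma orthogonal_cancel_left (hV : V ∈ orthogonalGroup n ℝ) (X : Matrix n n ℝ) :
    Vᵀ * (V * X) = X := by
  rw [← Matrix.mul_assoc, orthogonal_transpose_mul hV, Matrix.one_mul]

lemma orthogonal_cancel_left' (hV : V ∈ orthogonalGroup n ℝ) (X : Matrix n n ℝ) :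
    V * (Vᵀ * X) = X := by
  rw [← Matrix.mul_assoc, orthogonal_mul_transpose hV, Matrix.one_mul]

lemma orthogonal_isUnit (hV : V ∈ orthogonalGroup n ℝ) : IsUnit V :=
  IsUnit.of_mul_eq_one Vᵀ (orthogonal_mul_transpose hV)

lemma orthogonal_inv (hV : V ∈ orthogonalGroup n ℝ) : V⁻¹ = Vᵀ :=
  inv_eq_right_inv (orthogonal_mul_transpose hV)

lemma conj_mul_conj (hV : V ∈ orthogonalGroup n ℝ) (X Y : Matrix n n ℝ) :
    V * X * Vᵀ * (V * Y * Vᵀ) = V * (X * Y) * Vᵀ := by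
  simp only [Matrix.mul_assoc, orthogonal_cancel_left hV]

lemma trace_conj (hV : V ∈ orthogonalGroup n ℝ) (X : Matrix n n ℝ) :
    (V * X * Vᵀ).trace = X.trace := by
  rw [trace_mul_cycle, orthogonal_transpose_mul hV, Matrix.one_mul]

lemma det_conj (hV : V ∈ orthogonalGroup n ℝ) (X : Matrix n n ℝ) :
    (V * X * Vᵀ).det = X.det := by
  rw [det_mul_comm, ← Matrix.mul_assoc, orthogonal_transpose_mul hV, Matrix.one_mul]

lemma inv_conj (hV : V ∈ orthogonalGroup n ℝ) (X : Matrix n n ℝ) :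
    (V * X * Vᵀ)⁻¹ = V * X⁻¹ * Vᵀ := by
  rw [Matrix.mul_inv_rev, Matrix.mul_inv_rev, orthogonal_inv hV, orthogonal_inv (orthogonal_transpose_mem hV),
    transpose_transpose, Matrix.mul_assoc]

lemma conj_eq_iff (hV : V ∈ orthogonalGroup n ℝ) {X Y : Matrix n n ℝ} :
    V * X * Vᵀ = Y ↔ X = Vᵀ * Y * V := by
  constructor
  · rintro rfl
    simp only [Matrix.mul_assoc, orthogonal_cancel_left hV, orthogonal_transpose_mul hV,
      Matrix.mul_one]
  · rintro rfl
    simp only [Matrix.mul_assoc, orthogonal_cancel_left' hV, orthogonal_mul_transpose hV,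
      Matrix.mul_one]

lemma posSemidef_conj_iff (hV : V ∈ orthogonalGroup n ℝ) {X : Matrix n n ℝ} :
    (V * X * Vᵀ).PosSemidef ↔ X.PosSemidef := by
  simpa [star_eq_conjTranspose] using
    IsUnit.posSemidef_star_right_conjugate_iff (x := X) (orthogonal_isUnit hV)

lemma posDef_conj_iff (hV : V ∈ orthogonalGroup n ℝ) {X : Matrix n n ℝ} :
    (V * X * Vᵀ).PosDef ↔ X.PosDef := by
  simpa [star_eq_conjTranspose] using
    IsUnit.posDef_star_right_conjugate_iff (x := X) (orthogonal_isUnit hV)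

lemma trace_sq_conj_diagonal (hV : V ∈ orthogonalGroup n ℝ) (x : n → ℝ) :
    (V * diagonal x * Vᵀ * (V * diagonal x * Vᵀ)).trace = ∑ i, x i * x i := by
  rw [conj_mul_conj hV, trace_conj hV, diagonal_mul_diagonal, trace_diagonal]

lemma trace_diagonal_mul_conj (x y : n → ℝ) (V : Matrix n n ℝ) :
    (diagonal y * (V * diagonal x * Vᵀ)).trace = ∑ i, ∑ j, V i j ^ 2 * (y i * x j) := by
  rw [trace]
  refine Finset.sum_congr rfl fun i _ => ?_
  rw [diag_apply, diagonal_mul, mul_apply, Finset.mul_sum]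
  refine Finset.sum_congr rfl fun j _ => ?_
  rw [mul_diagonal, transpose_apply]
  ring

lemma sum_row_sq_orthogonal (hV : V ∈ orthogonalGroup n ℝ) (i : n) : ∑ j, V i j ^ 2 = 1 := by
  have h := congr_fun (congr_fun (orthogonal_mul_transpose hV) i) i
  rw [mul_apply, one_apply_eq] at h
  simpa [sq] using h

lemma sum_col_sq_orthogonal (hV : V ∈ orthogonalGroup n ℝ) (j : n) : ∑ i, V i j ^ 2 = 1 :=
  sum_row_sq_orthogonal (orthogonal_transpose_mem hV) j

lemma sq_mem_doublyStochastic (hV : V ∈ orthogonalGroup n ℝ) :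
    (of fun i j => V i j ^ 2) ∈ doublyStochastic ℝ n := by
  rw [mem_doublyStochastic_iff_sum]
  exact ⟨fun i j => sq_nonneg _, sum_row_sq_orthogonal hV, sum_col_sq_orthogonal hV⟩

/-- By Birkhoff, `M` is a convex combination of permutation matrices, and for each permutation this
is the rearrangement inequality. -/
lemma sum_doublyStochastic_le {M : Matrix n n ℝ} (hM : M ∈ doublyStochastic ℝ n)
    {x y : n → ℝ} (hxy : Monovary y x) : ∑ i, ∑ j, M i j * (y i * x j) ≤ ∑ i, y i * x i := by
  obtain ⟨w, hw0, hw1, rfl⟩ := exists_eq_sum_perm_of_mem_doublyStochastic hM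
  have key : ∑ i, ∑ j, (∑ σ, w σ • σ.permMatrix ℝ) i j * (y i * x j)
      = ∑ σ : Equiv.Perm n, w σ * ∑ i, y i * x (σ i) := by
    simp only [Matrix.sum_apply, Matrix.smul_apply, Finset.sum_mul, smul_eq_mul]
    calc _ = ∑ i, ∑ σ : Equiv.Perm n, ∑ j, w σ * σ.permMatrix ℝ i j * (y i * x j) :=
          Finset.sum_congr rfl fun i _ => Finset.sum_comm
      _ = ∑ σ : Equiv.Perm n, ∑ i, ∑ j, w σ * σ.permMatrix ℝ i j * (y i * x j) := Finset.sum_comm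
      _ = _ := by
          simp [Equiv.Perm.permMatrix, PEquiv.toMatrix_apply, Finset.mul_sum, eq_comm]
  rw [key, ← one_mul (∑ i, y i * x i), ← hw1, Finset.sum_mul]
  exact Finset.sum_le_sum fun σ _ =>
    mul_le_mul_of_nonneg_left (hxy.sum_mul_comp_perm_le_sum_mul) (hw0 σ)

end Orthogonal

/-! ### Von Neumann's trace inequality and its equality case. -/

section Sorted

variable {p : ℕ}

lemma Matrix.IsHermitian.exists_orthogonal_diagonal {A : Matrix (Fin p) (Fin p) ℝ}
    (hA : A.IsHermitian) : ∃ U ∈ orthogonalGroup (Fin p) ℝ, ∃ a : Fin p → ℝ, Monotone a ∧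
      A = U * diagonal a * Uᵀ := by
  have hU := hA.eigenvectorUnitary.2
  set U : Matrix (Fin p) (Fin p) ℝ := hA.eigenvectorUnitary.1 with hUdef
  have hs : A = U * diagonal hA.eigenvalues * Uᵀ := by
    have := hA.spectral_theorem
    rw [Unitary.conjStarAlgAut_apply] at this
    simpa [star_eq_conjTranspose] using this
  let σ := Tuple.sort hA.eigenvalues
  refine ⟨U.submatrix id σ, ?_, hA.eigenvalues ∘ σ, Tuple.monotone_sort _, ?_⟩
  · rw [mem_orthogonalGroup_iff_mul_transpose, transpose_submatrix, submatrix_mul_equiv,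
      orthogonal_mul_transpose hU, submatrix_id_id]
  · have : diagonal (hA.eigenvalues ∘ σ) = (diagonal hA.eigenvalues).submatrix σ σ := by
      rw [submatrix_diagonal_equiv]
    rw [this, transpose_submatrix, submatrix_mul_equiv, submatrix_mul_equiv, submatrix_id_id, ← hs]

lemma trace_diagonal_mul_conj_le {x y : Fin p → ℝ} (hx : Monotone x) (hy : Monotone y)
    {V : Matrix (Fin p) (Fin p) ℝ} (hV : V ∈ orthogonalGroup (Fin p) ℝ) :
    (diagonal y * (V * diagonal x * Vᵀ)).trace ≤ ∑ i, y i * x i := by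
  rw [trace_diagonal_mul_conj]
  exact sum_doublyStochastic_le (sq_mem_doublyStochastic hV) (hy.monovary hx)

/-- An eigenbasis of the sum V diag x Vᵀ + diag y, ordered by increasing eigenvalue, already
diagonalizes both summands in sorted order. This handles repeated entries without any discussion of
blocks. -/
lemma trace_diagonal_mul_conj_eq_iff {x y : Fin p → ℝ} (hx : Monotone x) (hy : Monotone y)
    {V : Matrix (Fin p) (Fin p) ℝ} (hV : V ∈ orthogonalGroup (Fin p) ℝ) :
    (diagonal y * (V * diagonal x * Vᵀ)).trace = ∑ i, y i * x i ↔
      ∃ W ∈ orthogonalGroup (Fin p) ℝ, W * diagonal y * Wᵀ = diagonal y ∧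
        V * diagonal x * Vᵀ = W * diagonal x * Wᵀ := by
  constructor
  · intro h
    obtain ⟨W, hW, z, hz, hWz⟩ := ((isHermitian_conj (isHermitian_diagonal x) V).add
      (isHermitian_diagonal y)).exists_orthogonal_diagonal
    have hWt := orthogonal_transpose_mem hW
    have hWV : Wᵀ * V ∈ orthogonalGroup (Fin p) ℝ := mul_mem hWt hV
    set A := Wᵀ * V * diagonal x * (Wᵀ * V)ᵀ with hA
    set Y := Wᵀ * diagonal y * Wᵀᵀ with hY
    have hA' : A = Wᵀ * (V * diagonal x * Vᵀ) * Wᵀᵀ := by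
      simp [hA, Matrix.mul_assoc]
    have hAY : A + Y = diagonal z := by
      rw [hA', hY, ← Matrix.add_mul, ← Matrix.mul_add, hWz, transpose_transpose, eq_comm,
        ← conj_eq_iff hW]
    have hYA : (Y * A).trace = ∑ i, y i * x i := by
      rw [hA', hY, conj_mul_conj hWt, trace_conj hWt, h]
    have hAA : (A * A).trace = ∑ i, x i * x i := trace_sq_conj_diagonal hWV x
    have hYY : (Y * Y).trace = ∑ i, y i * y i := trace_sq_conj_diagonal hWt y
    have hzA : (diagonal z * A).trace = ∑ i, x i * x i + ∑ i, y i * x i := by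
      rw [← hAY, Matrix.add_mul, trace_add, hAA, hYA]
    have hzY : (diagonal z * Y).trace = ∑ i, y i * x i + ∑ i, y i * y i := by
      rw [← hAY, Matrix.add_mul, trace_add, hYY, trace_mul_comm, hYA]
    have hzz : ∑ i, z i * z i = (diagonal z * A).trace + (diagonal z * Y).trace := by
      rw [← trace_add, ← Matrix.mul_add, hAY, diagonal_mul_diagonal, trace_diagonal]
    have hzA_le := trace_diagonal_mul_conj_le hx hz hWV
    have hzY_le := trace_diagonal_mul_conj_le hy hz hWt
    -- Equality in the trace gives |z|² = |x + y|², while the trace inequality for A and Y gives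
    -- |z|² ≤ ⟨z, x + y⟩. Hence |z − (x + y)|² ≤ 0.
    have hsq : ∑ i, (z i - (x i + y i)) ^ 2 = 0 := by
      refine le_antisymm ?_ (Finset.sum_nonneg fun i _ => sq_nonneg _)
      have : ∑ i, (z i - (x i + y i)) ^ 2 = ∑ i, z i * z i - 2 * (∑ i, z i * x i + ∑ i, z i * y i)
          + (∑ i, x i * x i + 2 * ∑ i, y i * x i + ∑ i, y i * y i) := by
        simp only [Finset.mul_sum, ← Finset.sum_add_distrib, ← Finset.sum_sub_distrib]
        exact Finset.sum_congr rfl fun i _ => by ring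
      linarith
    have hzxy : z = x + y := by
      ext i
      have := (Finset.sum_eq_zero_iff_of_nonneg (fun i _ => sq_nonneg _)).1 hsq i (Finset.mem_univ i)
      simpa [sub_eq_zero] using this
    -- Tr(diag z · A) is now the sum of two traces, each at most its sorted value. The total attains
    -- the sum of these bounds, so each is attained; attainment for `x` says that A − diag x has
    -- Frobenius norm zero.
    have hxA := trace_diagonal_mul_conj_le hx hx hWV
    have hyA := trace_diagonal_mul_conj_le hx hy hWV
    have hsplit : (diagonal z * A).trace = (diagonal x * A).trace + (diagonal y * A).trace := by
      rw [hzxy, diagonal_add_eq, Matrix.add_mul, trace_add]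
    have hxA' : (diagonal x * A).trace = ∑ i, x i * x i := by
      rw [← hA] at hxA hyA
      linarith
    have hAx : A = diagonal x := by
      refine eq_of_trace_sub_mul_sub_eq_zero (isHermitian_conj (isHermitian_diagonal x) _)
        (isHermitian_diagonal x) ?_
      rw [Matrix.sub_mul, Matrix.mul_sub, Matrix.mul_sub, trace_sub, trace_sub, trace_sub, hAA, hxA',
        trace_mul_comm A, hxA', diagonal_mul_diagonal, trace_diagonal]
      ring
    have hYy : Y = diagonal y := by
      rw [hAx, hzxy, diagonal_add_eq] at hAY
      exact add_left_cancel hAY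
    refine ⟨W, hW, ?_, ?_⟩
    · exact (conj_eq_iff hW).2 (hYy.symm.trans hY)
    · exact ((conj_eq_iff hW).2 (hAx.symm.trans hA')).symm
  · rintro ⟨W, hW, h1, h2⟩
    rw [h2, ← h1, conj_mul_conj hW, trace_conj hW, diagonal_mul_diagonal, trace_diagonal]

/-- Negating `y` turns oppositely ordered vectors into similarly ordered ones; this is the form used
with y⁻¹. -/
lemma sum_le_trace_diagonal_mul_conj {x y : Fin p → ℝ} (hx : Monotone x) (hy : Antitone y)
    {V : Matrix (Fin p) (Fin p) ℝ} (hV : V ∈ orthogonalGroup (Fin p) ℝ) :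
    ∑ i, y i * x i ≤ (diagonal y * (V * diagonal x * Vᵀ)).trace := by
  have := trace_diagonal_mul_conj_le hx hy.neg hV
  simp only [← diagonal_neg, trace_neg, neg_mul,
    Finset.sum_neg_distrib] at this
  linarith

lemma trace_diagonal_mul_conj_eq_iff_of_antitone {x y : Fin p → ℝ} (hx : Monotone x)
    (hy : Antitone y) {V : Matrix (Fin p) (Fin p) ℝ} (hV : V ∈ orthogonalGroup (Fin p) ℝ) :
    (diagonal y * (V * diagonal x * Vᵀ)).trace = ∑ i, y i * x i ↔
      ∃ W ∈ orthogonalGroup (Fin p) ℝ, W * diagonal y * Wᵀ = diagonal y ∧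
        V * diagonal x * Vᵀ = W * diagonal x * Wᵀ := by
  have := trace_diagonal_mul_conj_eq_iff hx hy.neg hV
  simpa only [← diagonal_neg, Matrix.neg_mul, Matrix.mul_neg, trace_neg, neg_mul,
    Finset.sum_neg_distrib, neg_inj] using this

lemma increasing_monotone (x : Fin p → ℝ) : Monotone (increasing x) := Tuple.monotone_sort x

end Sorted

/-! ### Reduction of the extended-valued properties to real-valued ones. -/

section Builders

variable {p : ℕ} {P Q : Matrix (Fin p) (Fin p) ℝ → Prop}
  {D : Matrix (Fin p) (Fin p) ℝ → Matrix (Fin p) (Fin p) ℝ → EReal}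
  {F : Matrix (Fin p) (Fin p) ℝ → Matrix (Fin p) (Fin p) ℝ → ℝ}

/-- A matrix commuting with a diagonal matrix of distinct entries vanishes off the diagonal, so it
commutes with every diagonal matrix. -/
lemma orthogonal_diagonal_conj_of_commute {y : Fin p → ℝ} (hy : Function.Injective y)
    {W : Matrix (Fin p) (Fin p) ℝ} (hW : W ∈ orthogonalGroup (Fin p) ℝ)
    (h : W * diagonal y * Wᵀ = diagonal y) (x : Fin p → ℝ) :
    W * diagonal x * Wᵀ = diagonal x := by
  have hc : W * diagonal y = diagonal y * W := by
    conv_rhs => rw [← h, Matrix.mul_assoc, orthogonal_transpose_mul hW, Matrix.mul_one]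
  have hc' : W * diagonal x = diagonal x * W := by
    ext i j
    have hij := congr_fun (congr_fun hc i) j
    rw [mul_diagonal, diagonal_mul] at hij ⊢
    by_cases hW0 : W i j = 0
    · simp [hW0]
    · have : y j = y i := by
        rw [mul_comm] at hij
        exact mul_right_cancel₀ hW0 hij
      rw [hy this, mul_comm]
  rw [hc', Matrix.mul_assoc, orthogonal_mul_transpose hW, Matrix.mul_one]

lemma EReal.coe_sum_real {ι : Type*} (s : Finset ι) (f : ι → ℝ) :
    ((∑ i ∈ s, f i : ℝ) : EReal) = ∑ i ∈ s, (f i : EReal) :=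
  map_sum (⟨⟨Real.toEReal, EReal.coe_zero⟩, EReal.coe_add⟩ : ℝ →+ EReal) f s

lemma EReal.sum_eq_top_of_nonneg {ι : Type*} [Fintype ι] {f : ι → EReal} (hf : ∀ i, 0 ≤ f i)
    {i : ι} (hi : f i = ⊤) : ∑ i, f i = ⊤ :=
  top_le_iff.1 (hi ▸ Finset.single_le_sum (fun i _ => hf i) (Finset.mem_univ i))

/-- A divergence that is real-valued exactly on a product of orthogonally invariant sets is spectral
as soon as its real-valued restriction is. -/
lemma isSpectralDivergence_of {q r : ℝ → Prop} {d : ℝ → ℝ → EReal} {f : ℝ → ℝ → ℝ}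
    (hD : ∀ X Y, P X → Q Y → D X Y = F X Y) (hD' : ∀ X Y, ¬(P X ∧ Q Y) → D X Y = ⊤)
    (hd : ∀ a b, q a → r b → d a b = f a b) (hd' : ∀ a b, ¬(q a ∧ r b) → d a b = ⊤)
    (hP : ∀ V ∈ orthogonalGroup (Fin p) ℝ, ∀ X, P (V * X * Vᵀ) ↔ P X)
    (hQ : ∀ V ∈ orthogonalGroup (Fin p) ℝ, ∀ X, Q (V * X * Vᵀ) ↔ Q X)
    (hPd : ∀ x : Fin p → ℝ, P (diagonal x) ↔ ∀ i, q (x i))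
    (hQd : ∀ x : Fin p → ℝ, Q (diagonal x) ↔ ∀ i, r (x i))
    (hF : ∀ V ∈ orthogonalGroup (Fin p) ℝ, ∀ X Y, P X → Q Y →
      F (V * X * Vᵀ) (V * Y * Vᵀ) = F X Y)
    (hf : ∀ a b, q a → r b → 0 ≤ f a b)
    (hFd : ∀ x y : Fin p → ℝ, (∀ i, q (x i)) → (∀ i, r (y i)) →
      F (diagonal x) (diagonal y) = ∑ i, f (x i) (y i))
    (hsmooth : ∀ b, r b → ContDiffOn ℝ 2 (fun a => f a b) (Set.Ioi 0))
    (hle : ∀ x y : Fin p → ℝ, Monotone x → Monotone y → (∀ i, q (x i)) → (∀ i, r (y i)) →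
      ∀ V ∈ orthogonalGroup (Fin p) ℝ,
        F (diagonal x) (diagonal y) ≤ F (V * diagonal x * Vᵀ) (diagonal y))
    (heq : ∀ x y : Fin p → ℝ, Monotone x → Monotone y → (∀ i, q (x i)) → (∀ i, r (y i)) →
      ∀ V ∈ orthogonalGroup (Fin p) ℝ,
        F (V * diagonal x * Vᵀ) (diagonal y) = F (diagonal x) (diagonal y) →
        ∃ W ∈ orthogonalGroup (Fin p) ℝ, W * diagonal y * Wᵀ = diagonal y ∧
          V * diagonal x * Vᵀ = W * diagonal x * Wᵀ) :
    IsSpectralDivergence D d := by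
  have hequi : ∀ X Y, ∀ V ∈ orthogonalGroup (Fin p) ℝ,
      D X Y = D (V * X * Vᵀ) (V * Y * Vᵀ) := by
    intro X Y V hV
    by_cases h : P X ∧ Q Y
    · rw [hD _ _ h.1 h.2, hD _ _ ((hP V hV X).2 h.1) ((hQ V hV Y).2 h.2), hF V hV X Y h.1 h.2]
    · rw [hD' _ _ h, hD' _ _ (by rwa [hP V hV, hQ V hV])]
  have hd0 : ∀ a b, 0 ≤ d a b := by
    intro a b
    by_cases h : q a ∧ r b
    · rw [hd _ _ h.1 h.2]; exact_mod_cast hf a b h.1 h.2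
    · rw [hd' _ _ h]; exact le_top
  have heq_iff : ∀ x y : Fin p → ℝ, ∀ V ∈ orthogonalGroup (Fin p) ℝ,
      D (V * diagonal (increasing x) * Vᵀ) (diagonal (increasing y)) < ⊤ →
      (D (V * diagonal (increasing x) * Vᵀ) (diagonal (increasing y)) =
          D (diagonal (increasing x)) (diagonal (increasing y)) ↔
        ∃ W ∈ orthogonalGroup (Fin p) ℝ,
          W * diagonal (increasing y) * Wᵀ = diagonal (increasing y) ∧
          V * diagonal (increasing x) * Vᵀ = W * diagonal (increasing x) * Wᵀ) := by
    intro x y V hV hlt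
    constructor
    · intro h
      have hPQ : P (V * diagonal (increasing x) * Vᵀ) ∧ Q (diagonal (increasing y)) := by
        by_contra hc
        exact hlt.ne (hD' _ _ hc)
      have hPx := (hP V hV _).1 hPQ.1
      rw [hD _ _ hPQ.1 hPQ.2, hD _ _ hPx hPQ.2, EReal.coe_eq_coe_iff] at h
      exact heq _ _ (increasing_monotone x) (increasing_monotone y) ((hPd _).1 hPx)
        ((hQd _).1 hPQ.2) V hV h
    · rintro ⟨W, hW, h1, h2⟩
      -- Both arguments become conjugates by the same `W`, so equivariance applies.
      conv_lhs => rw [h2, ← h1]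
      exact (hequi _ _ W hW).symm
  refine ⟨fun X Y _ _ => hequi X Y, fun a b _ _ => hd0 a b, fun x y _ _ => ?_, fun b _ => ?_,
    fun x y _ _ V hV => ?_, fun x y _ _ => heq_iff x y, fun x y _ _ hy V hV hlt => ?_⟩
  · by_cases h : P (diagonal x) ∧ Q (diagonal y)
    · rw [hD _ _ h.1 h.2, hFd x y ((hPd x).1 h.1) ((hQd y).1 h.2), EReal.coe_sum_real]
      exact Finset.sum_congr rfl fun i _ => (hd _ _ ((hPd x).1 h.1 i) ((hQd y).1 h.2 i)).symm
    · rw [hD' _ _ h]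
      rw [hPd, hQd, ← forall_and, not_forall] at h
      obtain ⟨i, hi⟩ := h
      exact (EReal.sum_eq_top_of_nonneg (fun i => hd0 _ _) (hd' _ _ hi)).symm
  · by_cases hb : r b
    · refine ((hsmooth b hb).mono ?_).congr ?_
      · rw [← interior_Ici]
        exact interior_mono fun a ha => ha.1
      · intro a ha
        have ha' : q a := by
          by_contra hc
          exact (interior_subset ha).2.ne (hd' _ _ fun h => hc h.1)
        simp only [hd a b ha' hb, EReal.toReal_coe]
    · have : {a | 0 ≤ a ∧ d a b < ⊤} = ∅ := by
        ext a
        simp [hd' a b fun h => hb h.2]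
      rw [this, interior_empty]
      exact contDiffOn_empty
  · by_cases h : P (diagonal (increasing x)) ∧ Q (diagonal (increasing y))
    · rw [hD _ _ h.1 h.2, hD _ _ ((hP V hV _).2 h.1) h.2, EReal.coe_le_coe_iff]
      exact hle _ _ (increasing_monotone x) (increasing_monotone y) ((hPd _).1 h.1)
        ((hQd _).1 h.2) V hV
    · rw [hD' (V * _ * Vᵀ) _ (by rwa [hP V hV])]
      exact le_top
  · rw [heq_iff x y V hV hlt]
    constructor
    · rintro ⟨W, hW, h1, h2⟩
      rw [h2, orthogonal_diagonal_conj_of_commute (hy.comp (Tuple.sort y).injective) hW h1]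
    · intro h
      exact ⟨1, one_mem _, by simp, by simpa using h⟩

/-- A divergence that is real-valued exactly on a product set is convex as soon as its
real-valued restriction is and it is continuous up to the boundary. -/
lemma isConvexDivergence_of
    (hD : ∀ X Y, P X → Q Y → D X Y = F X Y) (hD' : ∀ X Y, ¬(P X ∧ Q Y) → D X Y = ⊤)
    (hnonneg : ∀ X Y, P X → Q Y → 0 ≤ F X Y)
    (hzero : ∀ X Y, P X → Q Y → (F X Y = 0 ↔ X = Y))
    (hconv : ∀ S, Q S → ∀ X Y, P X → P Y → ∀ t : ℝ, 0 ≤ t → t ≤ 1 →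
      P (t • X + (1 - t) • Y) ∧ F (t • X + (1 - t) • Y) S ≤ t * F X S + (1 - t) * F Y S)
    (hcont : ∀ S, Q S → ContinuousOn (fun X => D X S) {X | X.PosSemidef})
    (hdiff : ∀ S, Q S → DifferentiableOn ℝ (fun X => F X S) {X | X.PosDef})
    (hcoer : ∀ S, Q S → ∃ h : ℝ → ℝ, Filter.Tendsto h Filter.atTop Filter.atTop ∧
      ∀ X, P X → h (frobNorm X) ≤ F X S) :
    IsConvexDivergence D := by
  have h0 : ∀ X Y, 0 ≤ D X Y := by
    intro X Y
    by_cases h : P X ∧ Q Y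
    · rw [hD _ _ h.1 h.2]; exact_mod_cast hnonneg X Y h.1 h.2
    · rw [hD' _ _ h]; exact le_top
  have hdom : ∀ X Y, D X Y < ⊤ → P X ∧ Q Y := by
    intro X Y h
    by_contra hc
    exact h.ne (hD' _ _ hc)
  refine ⟨fun X Y _ _ => h0 X Y, fun X Y _ _ h => ?_, fun S _ X Y _ _ t ht0 ht1 => ?_,
    fun S _ => ?_, fun S _ => ?_, fun S _ => ?_⟩
  · obtain ⟨hX, hY⟩ := hdom X Y h
    rw [hD _ _ hX hY, ← hzero X Y hX hY]
    exact_mod_cast Iff.rfl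
  · have hs0 : 0 ≤ 1 - t := sub_nonneg.2 ht1
    have hn1 : 0 ≤ (t : EReal) * D X S := mul_nonneg (by exact_mod_cast ht0) (h0 _ _)
    have hn2 : 0 ≤ ((1 - t : ℝ) : EReal) * D Y S := mul_nonneg (by exact_mod_cast hs0) (h0 _ _)
    -- The endpoints are separate because 0 · ⊤ = 0 in `EReal`: only a strictly positive weight
    -- makes the right-hand side infinite when one of the values is.
    rcases ht0.eq_or_lt with rfl | ht0'
    · simp
    rcases ht1.eq_or_lt with rfl | ht1'
    · simp
    have hs0' : 0 < 1 - t := sub_pos.2 ht1'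
    by_cases hX : P X ∧ Q S
    · by_cases hY : P Y
      · obtain ⟨h1, h2⟩ := hconv S hX.2 X Y hX.1 hY t ht0 ht1
        rw [hD _ _ h1 hX.2, hD _ _ hX.1 hX.2, hD _ _ hY hX.2]
        exact_mod_cast h2
      · rw [hD' Y S (fun h => hY h.1), EReal.coe_mul_top_of_pos hs0']
        rw [EReal.add_top_of_ne_bot (ne_of_gt (lt_of_lt_of_le EReal.bot_lt_zero hn1))]
        exact le_top
    · rw [hD' X S hX, EReal.coe_mul_top_of_pos ht0',
        EReal.top_add_of_ne_bot (ne_of_gt (lt_of_lt_of_le EReal.bot_lt_zero hn2))]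
      exact le_top
  · by_cases hS : Q S
    · exact hcont S hS
    · exact continuousOn_const.congr fun X _ => hD' X S fun h => hS h.2
  · by_cases hS : Q S
    · refine ((hdiff S hS).mono fun X hX => hX.1).congr fun X hX => ?_
      simp only [hD X S (hdom X S hX.2).1 hS, EReal.toReal_coe]
    · have : {X | X.PosDef ∧ D X S < ⊤} = ∅ := by
        ext X
        simp [hD' X S fun h => hS h.2]
      rw [this]
      exact differentiableOn_empty
  · by_cases hS : Q S
    · obtain ⟨h, hh, hle⟩ := hcoer S hS
      rw [EReal.tendsto_nhds_top_iff_real]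
      intro M
      have := (hh.comp (Filter.tendsto_comap (f := frobNorm (p := p)))).mono_left
        (inf_le_left (b := Filter.principal {X | X.PosSemidef}))
      filter_upwards [this.eventually_gt_atTop M] with X hX
      by_cases hPX : P X
      · rw [hD X S hPX hS]
        exact_mod_cast hX.trans_le (hle X hPX)
      · rw [hD' X S fun h => hPX h.1]
        exact EReal.coe_lt_top M
    · exact tendsto_const_nhds.congr fun X => (hD' X S fun h => hS h.2).symm

end Builders

/-! ### Convexity of trace functions. -/

section TraceFunctions

variable {n : Type*} [Fintype n] [DecidableEq n]

lemma conj_diagonal_apply_diag (U : Matrix n n ℝ) (a : n → ℝ) (i : n) :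
    (U * diagonal a * Uᵀ) i i = ∑ j, U i j ^ 2 * a j := by
  rw [mul_apply]
  refine Finset.sum_congr rfl fun j _ => ?_
  rw [mul_diagonal, transpose_apply]
  ring

lemma conj_diagonal_apply_diag_mem {s : Set ℝ} (hs : Convex ℝ s) {U : Matrix n n ℝ}
    (hU : U ∈ orthogonalGroup n ℝ) {a : n → ℝ} (ha : ∀ i, a i ∈ s) (i : n) :
    (U * diagonal a * Uᵀ) i i ∈ s := by
  rw [conj_diagonal_apply_diag]
  exact hs.sum_mem (fun j _ => sq_nonneg _) (sum_row_sq_orthogonal hU i) fun j _ => ha j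

/-- Peierls' inequality. -/
lemma sum_map_conj_diagonal_apply_diag_le {s : Set ℝ} {f : ℝ → ℝ} (hf : ConvexOn ℝ s f)
    {U : Matrix n n ℝ} (hU : U ∈ orthogonalGroup n ℝ) {a : n → ℝ} (ha : ∀ i, a i ∈ s) :
    ∑ i, f ((U * diagonal a * Uᵀ) i i) ≤ ∑ i, f (a i) := by
  calc ∑ i, f ((U * diagonal a * Uᵀ) i i) ≤ ∑ i, ∑ j, U i j ^ 2 * f (a j) := by
        refine Finset.sum_le_sum fun i _ => ?_
        rw [conj_diagonal_apply_diag]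
        exact hf.map_sum_le (fun j _ => sq_nonneg _) (sum_row_sq_orthogonal hU i) fun j _ => ha j
    _ = ∑ i, f (a i) := by
        rw [Finset.sum_comm]
        refine Finset.sum_congr rfl fun j _ => ?_
        rw [← Finset.sum_mul, sum_col_sq_orthogonal hU, one_mul]

/-- The trace of a convex function of a symmetric matrix is convex. -/
lemma sum_map_eigenvalues_convex {s : Set ℝ} {f : ℝ → ℝ} (hf : ConvexOn ℝ s f)
    {U V W : Matrix n n ℝ} (hU : U ∈ orthogonalGroup n ℝ) (hV : V ∈ orthogonalGroup n ℝ)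
    (hW : W ∈ orthogonalGroup n ℝ) {a b c : n → ℝ} (ha : ∀ i, a i ∈ s) (hb : ∀ i, b i ∈ s)
    {t : ℝ} (ht0 : 0 ≤ t) (ht1 : t ≤ 1)
    (h : t • (U * diagonal a * Uᵀ) + (1 - t) • (V * diagonal b * Vᵀ) = W * diagonal c * Wᵀ) :
    ∑ i, f (c i) ≤ t * ∑ i, f (a i) + (1 - t) * ∑ i, f (b i) := by
  have hWt := orthogonal_transpose_mem hW
  have hWU := mul_mem hWt hU
  have hWV := mul_mem hWt hV
  -- In the eigenbasis of the combination, each `c i` is a convex combination of diagonal entries.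
  -- Scalar convexity splits it, and Peierls' inequality bounds the two diagonal sums.
  have hc : diagonal c = t • (Wᵀ * U * diagonal a * (Wᵀ * U)ᵀ) +
      (1 - t) • (Wᵀ * V * diagonal b * (Wᵀ * V)ᵀ) := by
    rw [(conj_eq_iff hW).1 h.symm]
    simp [Matrix.mul_add, Matrix.add_mul, Matrix.mul_assoc]
  have hci : ∀ i, c i = t • (Wᵀ * U * diagonal a * (Wᵀ * U)ᵀ) i i +
      (1 - t) • (Wᵀ * V * diagonal b * (Wᵀ * V)ᵀ) i i := by
    intro i
    simpa using congr_fun (congr_fun hc i) i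
  calc ∑ i, f (c i) ≤ ∑ i, (t * f ((Wᵀ * U * diagonal a * (Wᵀ * U)ᵀ) i i) +
        (1 - t) * f ((Wᵀ * V * diagonal b * (Wᵀ * V)ᵀ) i i)) := by
        refine Finset.sum_le_sum fun i _ => ?_
        rw [hci]
        exact hf.2 (conj_diagonal_apply_diag_mem hf.1 hWU ha i)
          (conj_diagonal_apply_diag_mem hf.1 hWV hb i) ht0 (sub_nonneg.2 ht1) (by ring)
    _ ≤ _ := by
        rw [Finset.sum_add_distrib, ← Finset.mul_sum, ← Finset.mul_sum]
        exact add_le_add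
          (mul_le_mul_of_nonneg_left (sum_map_conj_diagonal_apply_diag_le hf hWU ha) ht0)
          (mul_le_mul_of_nonneg_left (sum_map_conj_diagonal_apply_diag_le hf hWV hb)
            (sub_nonneg.2 ht1))

end TraceFunctions

/-! ### Positive semidefinite square roots. -/

section Sqrt

variable {n : Type*} [DecidableEq n]

lemma posSemidef_diagonal {x : n → ℝ} : (diagonal x).PosSemidef ↔ ∀ i, 0 ≤ x i :=
  posSemidef_diagonal_iff

lemma posDef_diagonal {x : n → ℝ} : (diagonal x).PosDef ↔ ∀ i, 0 < x i :=
  posDef_diagonal_iff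

variable [Fintype n]

lemma posSemidef_conj_diagonal {V : Matrix n n ℝ} (hV : V ∈ orthogonalGroup n ℝ) {x : n → ℝ} :
    (V * diagonal x * Vᵀ).PosSemidef ↔ ∀ i, 0 ≤ x i :=
  (posSemidef_conj_iff hV).trans posSemidef_diagonal

lemma posDef_conj_diagonal {V : Matrix n n ℝ} (hV : V ∈ orthogonalGroup n ℝ) {x : n → ℝ} :
    (V * diagonal x * Vᵀ).PosDef ↔ ∀ i, 0 < x i :=
  (posDef_conj_iff hV).trans posDef_diagonal

lemma sqrt_mul_sqrt_of_posSemidef {X : Matrix n n ℝ} (hX : X.PosSemidef) :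
    CFC.sqrt X * CFC.sqrt X = X := CFC.sqrt_mul_sqrt_self X hX.nonneg

lemma sqrt_posSemidef (X : Matrix n n ℝ) : (CFC.sqrt X).PosSemidef :=
  (CFC.sqrt_nonneg X).posSemidef

lemma sqrt_transpose (X : Matrix n n ℝ) : (CFC.sqrt X)ᵀ = CFC.sqrt X :=
  isHermitian_iff_transpose.1 (sqrt_posSemidef X).1

lemma sqrt_eq_of_mul_self {X Y : Matrix n n ℝ} (hY : Y.PosSemidef) (h : Y * Y = X) :
    CFC.sqrt X = Y := CFC.sqrt_unique h hY.nonneg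

lemma sqrt_conj {V : Matrix n n ℝ} (hV : V ∈ orthogonalGroup n ℝ) {X : Matrix n n ℝ}
    (hX : X.PosSemidef) : CFC.sqrt (V * X * Vᵀ) = V * CFC.sqrt X * Vᵀ :=
  sqrt_eq_of_mul_self ((posSemidef_conj_iff hV).2 (sqrt_posSemidef X)) <| by
    rw [conj_mul_conj hV, sqrt_mul_sqrt_of_posSemidef hX]

lemma sqrt_diagonal {x : n → ℝ} (hx : ∀ i, 0 ≤ x i) :
    CFC.sqrt (diagonal x) = diagonal fun i => √(x i) :=
  sqrt_eq_of_mul_self (posSemidef_diagonal.2 fun i => Real.sqrt_nonneg _) <| by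
    simp [diagonal_mul_diagonal, hx]

lemma sqrt_conj_diagonal {V : Matrix n n ℝ} (hV : V ∈ orthogonalGroup n ℝ) {x : n → ℝ}
    (hx : ∀ i, 0 ≤ x i) :
    CFC.sqrt (V * diagonal x * Vᵀ) = V * (diagonal fun i => √(x i)) * Vᵀ := by
  rw [sqrt_conj hV (posSemidef_diagonal.2 hx), sqrt_diagonal hx]

lemma sqrt_posDef {X : Matrix n n ℝ} (hX : X.PosDef) : (CFC.sqrt X).PosDef := by
  rw [(sqrt_posSemidef X).posDef_iff_isUnit]
  have : IsUnit (CFC.sqrt X * CFC.sqrt X) := by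
    rw [sqrt_mul_sqrt_of_posSemidef hX.posSemidef]
    exact hX.isUnit
  exact isUnit_of_mul_isUnit_left this

end Sqrt

/-! ### Differentiability and continuity of matrix functions. -/

section Calculus

section Normed

open scoped Matrix.Norms.L2Operator

/-- The proof goes through the operator norm; later uses take place where no norm is open. -/
lemma DifferentiableOn.matrix_continuousOn {n : Type*} [Finite n]
    {f : Matrix n n ℝ → ℝ} {s : Set (Matrix n n ℝ)}
    (hf : DifferentiableOn ℝ f s) : ContinuousOn f s := by
  classical
  have := Fintype.ofFinite n
  exact hf.continuousOn

variable {n : Type*} [Fintype n]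

lemma differentiable_matrix_apply (i j : n) : Differentiable ℝ fun X : Matrix n n ℝ => X i j :=
  (entryLinearMap ℝ ℝ i j).toContinuousLinearMap.differentiable

variable [DecidableEq n]

lemma differentiable_matrix_trace_mul (A : Matrix n n ℝ) :
    Differentiable ℝ fun X : Matrix n n ℝ => (A * X).trace :=
  ((traceLinearMap n ℝ ℝ).comp (LinearMap.mulLeft ℝ A)).toContinuousLinearMap.differentiable

lemma differentiable_matrix_det : Differentiable ℝ fun X : Matrix n n ℝ => X.det := by
  have := differentiable_matrix_apply (n := n)
  simp only [det_apply]
  fun_prop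

lemma differentiableAt_matrix_inv {X : Matrix n n ℝ} (hX : IsUnit X) :
    DifferentiableAt ℝ (fun X : Matrix n n ℝ => X⁻¹) X := by
  have h := differentiableAt_inverse (𝕜 := ℝ) hX
  have he : (fun X : Matrix n n ℝ => X⁻¹) = Ring.inverse := funext nonsing_inv_eq_ringInverse
  rwa [he]

lemma differentiableAt_trace_inv_mul (S : Matrix n n ℝ) {X : Matrix n n ℝ} (hX : IsUnit X) :
    DifferentiableAt ℝ (fun X : Matrix n n ℝ => (X⁻¹ * S).trace) X := by
  simp only [fun X : Matrix n n ℝ => trace_mul_comm X⁻¹ S]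
  exact (differentiable_matrix_trace_mul S).differentiableAt.comp X (differentiableAt_matrix_inv hX)

lemma differentiable_trace_sub_sq_mul (S A : Matrix n n ℝ) :
    Differentiable ℝ fun X : Matrix n n ℝ => ((X - S) ^ 2 * A).trace := by
  simp only [fun X : Matrix n n ℝ => trace_mul_comm ((X - S) ^ 2) A]
  exact (differentiable_matrix_trace_mul A).comp (by fun_prop)

lemma continuousOn_matrix_sqrt :
    ContinuousOn (CFC.sqrt : Matrix n n ℝ → Matrix n n ℝ) {X | X.PosSemidef} := by
  simpa only [nonneg_iff_posSemidef] using CFC.continuousOn_sqrt (A := Matrix n n ℝ)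

end Normed

variable {n : Type*} [Fintype n] [DecidableEq n]

/-- An extended-real-valued function on positive semidefinite matrices that is finite and continuous
on positive definite matrices and dominates a negative multiple of `log det` is continuous. -/
lemma continuousOn_of_log_det_le {D : Matrix n n ℝ → EReal} {F L : Matrix n n ℝ → ℝ}
    (hD : ∀ X, X.PosDef → D X = F X) (hD' : ∀ X, ¬ X.PosDef → D X = ⊤)
    (hF : ContinuousOn F {X | X.PosDef}) (hL : Continuous L)
    (hFL : ∀ X, X.PosDef → L X - 1 / 2 * Real.log X.det ≤ F X) :
    ContinuousOn D {X | X.PosSemidef} := by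
  have hdet : Continuous fun X : Matrix n n ℝ => X.det := by fun_prop
  intro X hX
  by_cases hpd : X.PosDef
  -- Inside the cone, positive definiteness is nonvanishing of the determinant, an open condition.
  · have hev : ∀ᶠ Y in nhdsWithin X {X | X.PosSemidef}, Y.PosDef := by
      filter_upwards [self_mem_nhdsWithin,
        nhdsWithin_le_nhds (hdet.continuousAt.eventually_ne hpd.det_pos.ne')] with Y hY hne
      exact hY.posDef_iff_det_ne_zero.2 hne
    have hFX : ContinuousWithinAt F {X | X.PosSemidef} X := by
      refine (hF X hpd).mono_of_mem_nhdsWithin hev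
    refine ((continuous_coe_real_ereal.continuousAt.comp_continuousWithinAt hFX).congr_of_eventuallyEq
      (hev.mono fun Y hY => hD Y hY) (hD X hpd))
  · have h0 : X.det = 0 := by
      by_contra h
      exact hpd (hX.posDef_iff_det_ne_zero.2 h)
    rw [ContinuousWithinAt, hD' X hpd, EReal.tendsto_nhds_top_iff_real]
    intro M
    -- Near the singular `X`, L Y > L X − 1; together with this bound on log det Y it gives L Y − ½
    -- log det Y > M.
    have hlog : ∀ᶠ t in nhdsWithin (0 : ℝ) (Set.Ioi 0), Real.log t < 2 * (L X - 1 - M) :=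
      Real.tendsto_log_nhdsGT_zero.eventually_lt_atBot _
    rw [eventually_nhdsWithin_iff, ← h0] at hlog
    have h1 : ∀ᶠ Y in nhds X, L X - 1 < L Y :=
      hL.continuousAt.eventually (lt_mem_nhds (sub_one_lt _))
    filter_upwards [nhdsWithin_le_nhds h1,
      nhdsWithin_le_nhds (hdet.continuousAt.eventually hlog)] with Y hY1 hY2
    by_cases hY : Y.PosDef
    · have h2 := hY2 (by rw [h0]; exact hY.det_pos)
      rw [hD Y hY, EReal.coe_lt_coe_iff]
      have h3 := hFL Y hY
      linarith
    · rw [hD' Y hY]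
      exact EReal.coe_lt_top M

end Calculus

/-! ### Trace inequalities for positive semidefinite matrices. -/

section TraceBounds

variable {n : Type*} [Fintype n] [DecidableEq n]

/-- Cyclicity gives Tr(AB) = Tr(√B A √B), the trace of a positive semidefinite matrix. -/
lemma trace_mul_nonneg {A B : Matrix n n ℝ} (hA : A.PosSemidef) (hB : B.PosSemidef) :
    0 ≤ (A * B).trace := by
  rw [← sqrt_mul_sqrt_of_posSemidef hB, ← Matrix.mul_assoc, trace_mul_comm, ← Matrix.mul_assoc]
  have := (hA.conjTranspose_mul_mul_same (CFC.sqrt B)).trace_nonneg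
  rwa [(sqrt_posSemidef B).1] at this

lemma frobNorm_sq {p : ℕ} (X : Matrix (Fin p) (Fin p) ℝ) :
    frobNorm X ^ 2 = (Xᵀ * X).trace := by
  rw [frobNorm, Real.sq_sqrt]
  simpa using (posSemidef_conjTranspose_mul_self X).trace_nonneg

lemma trace_conj_diagonal {V : Matrix n n ℝ} (hV : V ∈ orthogonalGroup n ℝ) (x : n → ℝ) :
    (V * diagonal x * Vᵀ).trace = ∑ i, x i := by
  rw [trace_conj hV, trace_diagonal]

/-- On nonnegative eigenvalues the ℓ² norm is at most the ℓ¹ norm. -/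
lemma frobNorm_le_trace {p : ℕ} {X : Matrix (Fin p) (Fin p) ℝ} (hX : X.PosSemidef) :
    frobNorm X ≤ X.trace := by
  refine Real.sqrt_le_iff.2 ⟨hX.trace_nonneg, ?_⟩
  rw [isHermitian_iff_transpose.1 hX.1]
  obtain ⟨U, hU, x, -, rfl⟩ := hX.1.exists_orthogonal_diagonal
  rw [posSemidef_conj_diagonal hU] at hX
  rw [trace_sq_conj_diagonal hU, trace_conj_diagonal hU]
  simp only [← sq]
  exact Finset.sum_sq_le_sq_sum_of_nonneg fun i _ => hX i

/-- Take `c` to be the least eigenvalue of `A`, so that A − c·1 is positive semidefinite; for p = 0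
any positive `c` serves. -/
lemma exists_pos_mul_trace_le {p : ℕ} {A : Matrix (Fin p) (Fin p) ℝ} (hA : A.PosDef) :
    ∃ c > 0, ∀ X : Matrix (Fin p) (Fin p) ℝ, X.PosSemidef → c * X.trace ≤ (A * X).trace := by
  obtain ⟨U, hU, a, -, rfl⟩ := hA.1.exists_orthogonal_diagonal
  rw [posDef_conj_diagonal hU] at hA
  obtain ⟨c, hc, hca⟩ : ∃ c > 0, ∀ i, c ≤ a i := by
    rcases isEmpty_or_nonempty (Fin p) with h | h
    · exact ⟨1, one_pos, fun i => h.elim i⟩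
    · obtain ⟨i, hi⟩ := Finite.exists_min a
      exact ⟨a i, hA i, hi⟩
  refine ⟨c, hc, fun X hX => ?_⟩
  have h1 : (U * diagonal a * Uᵀ - c • 1).PosSemidef := by
    have : U * diagonal a * Uᵀ - c • 1 = U * diagonal (fun i => a i - c) * Uᵀ := by
      rw [← diagonal_sub, Matrix.mul_sub, Matrix.sub_mul, ← smul_one_eq_diagonal]
      simp [orthogonal_mul_transpose hU]
    rw [this, posSemidef_conj_diagonal hU]
    exact fun i => sub_nonneg.2 (hca i)
  have h2 := trace_mul_nonneg h1 hX
  rw [Matrix.sub_mul, trace_sub, smul_mul, Matrix.one_mul, trace_smul, smul_eq_mul] at h2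
  linarith

end TraceBounds

/-! ### Whitening: reduction to the spectrum of S^{-1/2} X S^{-1/2}. -/

section Whitening

variable {p : ℕ} {X S C U : Matrix (Fin p) (Fin p) ℝ} {z : Fin p → ℝ}

lemma exists_sqrt_inv (hS : S.PosDef) : ∃ C : Matrix (Fin p) (Fin p) ℝ, C.PosDef ∧ C * C = S⁻¹ :=
  ⟨CFC.sqrt S⁻¹, sqrt_posDef hS.inv, sqrt_mul_sqrt_of_posSemidef hS.inv.posSemidef⟩

lemma inv_diagonal_of_ne_zero {y : Fin p → ℝ} (hy : ∀ i, y i ≠ 0) :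
    (diagonal y)⁻¹ = diagonal fun i => (y i)⁻¹ :=
  inv_eq_right_inv (by simp [diagonal_mul_diagonal, hy])

lemma whiten_posDef (hX : X.PosDef) (hC : C.PosDef) : (C * X * C).PosDef := by
  have h := (IsUnit.posDef_star_right_conjugate_iff (x := X) hC.isUnit).2 hX
  rwa [star_eq_conjTranspose, hC.1] at h

lemma whiten_eigenvalues_pos (hX : X.PosDef) (hC : C.PosDef) (hU : U ∈ orthogonalGroup (Fin p) ℝ)
    (h : C * X * C = U * diagonal z * Uᵀ) (i : Fin p) : 0 < z i :=
  (posDef_conj_diagonal hU).1 (h ▸ whiten_posDef hX hC) i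

lemma trace_inv_mul_eq_sum (hCC : C * C = S⁻¹) (hU : U ∈ orthogonalGroup (Fin p) ℝ)
    (h : C * X * C = U * diagonal z * Uᵀ) : (S⁻¹ * X).trace = ∑ i, z i := by
  rw [← trace_conj_diagonal hU, ← h, ← hCC, trace_mul_cycle C X C]

/-- By cyclicity X⁻¹S has the trace of C⁻¹X⁻¹C⁻¹, the inverse of the whitened matrix. -/
lemma trace_inv_mul_eq_sum_inv (hX : X.PosDef) (hS : S.PosDef) (hC : C.PosDef)
    (hCC : C * C = S⁻¹) (hU : U ∈ orthogonalGroup (Fin p) ℝ)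
    (h : C * X * C = U * diagonal z * Uᵀ) : (X⁻¹ * S).trace = ∑ i, (z i)⁻¹ := by
  have hz := whiten_eigenvalues_pos hX hC hU h
  rw [← trace_conj_diagonal hU, ← inv_diagonal_of_ne_zero fun i => (hz i).ne', ← inv_conj hU, ← h,
    Matrix.mul_inv_rev, Matrix.mul_inv_rev, trace_mul_comm C⁻¹, Matrix.mul_assoc,
    ← Matrix.mul_inv_rev, hCC, nonsing_inv_nonsing_inv _ ((isUnit_iff_isUnit_det _).1 hS.isUnit)]

lemma log_det_mul_inv_eq (hX : X.PosDef) (hS : S.PosDef) :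
    Real.log (S * X⁻¹).det = Real.log S.det - Real.log X.det := by
  rw [det_mul, det_nonsing_inv, Ring.inverse_eq_inv', ← div_eq_mul_inv,
    Real.log_div hS.det_pos.ne' hX.det_pos.ne']

lemma log_det_mul_inv_eq_neg_sum (hX : X.PosDef) (hS : S.PosDef) (hC : C.PosDef)
    (hCC : C * C = S⁻¹) (hU : U ∈ orthogonalGroup (Fin p) ℝ)
    (h : C * X * C = U * diagonal z * Uᵀ) : Real.log (S * X⁻¹).det = -∑ i, Real.log (z i) := by
  have hz := whiten_eigenvalues_pos hX hC hU h
  have hdet : X.det / S.det = ∏ i, z i := by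
    rw [← det_diagonal, ← det_conj hU (diagonal z), ← h, det_mul, det_mul, mul_right_comm, ← det_mul, hCC,
      det_nonsing_inv, Ring.inverse_eq_inv', div_eq_inv_mul]
  rw [log_det_mul_inv_eq hX hS, ← Real.log_prod fun i _ => (hz i).ne', ← hdet,
    Real.log_div hX.det_pos.ne' hS.det_pos.ne']
  ring

lemma eq_of_whiten_eq_one (hS : S.PosDef) (hC : C.PosDef) (hCC : C * C = S⁻¹)
    (h : C * X * C = 1) : X = S := by
  have hdet := (isUnit_iff_isUnit_det _).1 hC.isUnit
  have hSi : S = C⁻¹ * C⁻¹ := by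
    rw [← Matrix.mul_inv_rev, hCC,
      nonsing_inv_nonsing_inv _ ((isUnit_iff_isUnit_det _).1 hS.isUnit)]
  calc X = C⁻¹ * (C * X * C) * C⁻¹ := by
        rw [Matrix.mul_assoc C, nonsing_inv_mul_cancel_left _ _ hdet,
          mul_nonsing_inv_cancel_right _ _ hdet]
    _ = S := by rw [h, Matrix.mul_one, hSi]

lemma whiten_self (hS : S.PosDef) (hCC : C * C = S⁻¹) : C * S * C = 1 := by
  have h1 : C * (C * S) = 1 := by
    rw [← Matrix.mul_assoc, hCC, nonsing_inv_mul _ ((isUnit_iff_isUnit_det _).1 hS.isUnit)]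
  exact mul_eq_one_comm.1 h1

variable {F : Matrix (Fin p) (Fin p) ℝ → Matrix (Fin p) (Fin p) ℝ → ℝ} {f : ℝ → ℝ}

/-- `F(X, S)` is the trace of `f(S^{-1/2} X S^{-1/2})`. -/
def IsRelativeTrace (F : Matrix (Fin p) (Fin p) ℝ → Matrix (Fin p) (Fin p) ℝ → ℝ) (f : ℝ → ℝ) :
    Prop :=
  ∀ X S C U : Matrix (Fin p) (Fin p) ℝ, ∀ z : Fin p → ℝ, X.PosDef → S.PosDef → C.PosDef →
    C * C = S⁻¹ → U ∈ orthogonalGroup (Fin p) ℝ → C * X * C = U * diagonal z * Uᵀ →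
    F X S = ∑ i, f (z i)

lemma IsRelativeTrace.nonneg (hF : IsRelativeTrace F f) (hf : ∀ z, 0 < z → 0 ≤ f z)
    (hX : X.PosDef) (hS : S.PosDef) : 0 ≤ F X S := by
  obtain ⟨C, hC, hCC⟩ := exists_sqrt_inv hS
  obtain ⟨U, hU, z, -, h⟩ := (whiten_posDef hX hC).1.exists_orthogonal_diagonal
  rw [hF X S C U z hX hS hC hCC hU h]
  exact Finset.sum_nonneg fun i _ => hf _ (whiten_eigenvalues_pos hX hC hU h i)

/-- A zero sum of nonnegative terms puts every whitened eigenvalue at 1, so C X C = 1 and whitening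
can be undone. -/
lemma IsRelativeTrace.eq_zero_iff (hF : IsRelativeTrace F f) (hf : ∀ z, 0 < z → 0 ≤ f z)
    (hf1 : ∀ z, 0 < z → (f z = 0 ↔ z = 1)) (hX : X.PosDef) (hS : S.PosDef) :
    F X S = 0 ↔ X = S := by
  obtain ⟨C, hC, hCC⟩ := exists_sqrt_inv hS
  constructor
  · intro h0
    obtain ⟨U, hU, z, -, h⟩ := (whiten_posDef hX hC).1.exists_orthogonal_diagonal
    have hz := whiten_eigenvalues_pos hX hC hU h
    rw [hF X S C U z hX hS hC hCC hU h,
      Finset.sum_eq_zero_iff_of_nonneg fun i _ => hf _ (hz i)] at h0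
    have hz1 : z = 1 := funext fun i => (hf1 _ (hz i)).1 (h0 i (Finset.mem_univ i))
    refine eq_of_whiten_eq_one hS hC hCC ?_
    rw [h, hz1, show diagonal (1 : Fin p → ℝ) = 1 from diagonal_one, Matrix.mul_one, orthogonal_mul_transpose hU]
  · rintro rfl
    rw [hF X X C 1 1 hX hX hC hCC (one_mem _) (by simp [whiten_self hX hCC])]
    simp [(hf1 1 one_pos).2 rfl]

/-- Whitening by a fixed `C` is linear in X, so convexity of the trace function carries over. -/
lemma IsRelativeTrace.convex (hF : IsRelativeTrace F f) (hf : ConvexOn ℝ (Set.Ioi 0) f)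
    {Y : Matrix (Fin p) (Fin p) ℝ} (hS : S.PosDef) (hX : X.PosDef) (hY : Y.PosDef) {t : ℝ}
    (ht0 : 0 ≤ t) (ht1 : t ≤ 1) :
    (t • X + (1 - t) • Y).PosDef ∧
      F (t • X + (1 - t) • Y) S ≤ t * F X S + (1 - t) * F Y S := by
  have hZ : (t • X + (1 - t) • Y).PosDef := by
    rcases ht0.eq_or_lt with rfl | ht0
    · simpa using hY
    · exact (hX.smul ht0).add_posSemidef (hY.posSemidef.smul (sub_nonneg.2 ht1))
  refine ⟨hZ, ?_⟩
  obtain ⟨C, hC, hCC⟩ := exists_sqrt_inv hS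
  obtain ⟨U, hU, a, -, ha⟩ := (whiten_posDef hX hC).1.exists_orthogonal_diagonal
  obtain ⟨V, hV, b, -, hb⟩ := (whiten_posDef hY hC).1.exists_orthogonal_diagonal
  obtain ⟨W, hW, c, -, hc⟩ := (whiten_posDef hZ hC).1.exists_orthogonal_diagonal
  rw [hF X S C U a hX hS hC hCC hU ha, hF Y S C V b hY hS hC hCC hV hb,
    hF _ S C W c hZ hS hC hCC hW hc]
  refine sum_map_eigenvalues_convex hf hU hV hW (whiten_eigenvalues_pos hX hC hU ha)
    (whiten_eigenvalues_pos hY hC hV hb) ht0 ht1 ?_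
  rw [← ha, ← hb, ← hc]
  simp [Matrix.mul_add, Matrix.add_mul]

end Whitening

/-! ### Kullback–Leibler and symmetrized Stein divergences. -/

section KullbackLeibler

variable {p : ℕ}

/-- The real-valued Kullback-Leibler divergence of positive definite matrices. -/
noncomputable def klReal (X Y : Matrix (Fin p) (Fin p) ℝ) : ℝ :=
  1 / 2 * ((Y⁻¹ * X).trace - p + Real.log (Y * X⁻¹).det)

/-- The real-valued symmetrized Stein divergence of positive definite matrices. -/
noncomputable def steinReal (X Y : Matrix (Fin p) (Fin p) ℝ) : ℝ :=
  1 / 2 * ((Y⁻¹ * X).trace + (X⁻¹ * Y).trace - 2 * p)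

lemma isRelativeTrace_klReal :
    IsRelativeTrace (klReal (p := p)) fun z => 1 / 2 * (z - 1 - Real.log z) := by
  intro X S C U z hX hS hC hCC hU h
  rw [klReal, trace_inv_mul_eq_sum hCC hU h, log_det_mul_inv_eq_neg_sum hX hS hC hCC hU h,
    ← Finset.mul_sum, Finset.sum_sub_distrib, Finset.sum_sub_distrib]
  simp
  ring

lemma isRelativeTrace_steinReal :
    IsRelativeTrace (steinReal (p := p)) fun z => 1 / 2 * (z + z⁻¹ - 2) := by
  intro X S C U z hX hS hC hCC hU h
  rw [steinReal, trace_inv_mul_eq_sum hCC hU h, trace_inv_mul_eq_sum_inv hX hS hC hCC hU h,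
    ← Finset.mul_sum, Finset.sum_sub_distrib, Finset.sum_add_distrib]
  simp
  ring

lemma sub_one_sub_log_nonneg {z : ℝ} (hz : 0 < z) : 0 ≤ 1 / 2 * (z - 1 - Real.log z) := by
  linarith [Real.log_le_sub_one_of_pos hz]

lemma sub_one_sub_log_eq_zero_iff {z : ℝ} (hz : 0 < z) :
    1 / 2 * (z - 1 - Real.log z) = 0 ↔ z = 1 := by
  constructor
  · intro h
    by_contra hne
    linarith [Real.log_lt_sub_one_of_pos hz hne]
  · rintro rfl
    simp

lemma add_inv_sub_two_eq {z : ℝ} (hz : 0 < z) :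
    1 / 2 * (z + z⁻¹ - 2) = 1 / 2 * ((z - 1) ^ 2 / z) := by
  field_simp
  ring

lemma add_inv_sub_two_nonneg {z : ℝ} (hz : 0 < z) : 0 ≤ 1 / 2 * (z + z⁻¹ - 2) := by
  rw [add_inv_sub_two_eq hz]
  positivity

lemma add_inv_sub_two_eq_zero_iff {z : ℝ} (hz : 0 < z) :
    1 / 2 * (z + z⁻¹ - 2) = 0 ↔ z = 1 := by
  rw [add_inv_sub_two_eq hz]
  simp [hz.ne', sub_eq_zero]

lemma convexOn_sub_one_sub_log : ConvexOn ℝ (Set.Ioi 0) fun z : ℝ => 1 / 2 * (z - 1 - Real.log z) := by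
  have h := strictConcaveOn_log_Ioi.concaveOn
  refine ⟨convex_Ioi 0, fun x hx y hy a b ha hb hab => ?_⟩
  have := h.2 hx hy ha hb hab
  simp only [smul_eq_mul] at this ⊢
  linear_combination (1 / 2) * this + (1 / 2) * hab

lemma convexOn_add_inv_sub_two : ConvexOn ℝ (Set.Ioi 0) fun z : ℝ => 1 / 2 * (z + z⁻¹ - 2) := by
  have h := convexOn_zpow (𝕜 := ℝ) (-1)
  refine ⟨convex_Ioi 0, fun x hx y hy a b ha hb hab => ?_⟩
  have := h.2 hx hy ha hb hab
  simp only [smul_eq_mul, _root_.zpow_neg_one] at this ⊢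
  linear_combination (1 / 2) * this + hab

/-- Eigenvalue by eigenvalue this is log(1/z) ≤ 1/z − 1. It hands the −½ log det barrier to the
Stein divergence. -/
lemma klReal_le_steinReal {X S : Matrix (Fin p) (Fin p) ℝ} (hX : X.PosDef) (hS : S.PosDef) :
    klReal X S ≤ steinReal X S := by
  obtain ⟨C, hC, hCC⟩ := exists_sqrt_inv hS
  obtain ⟨U, hU, z, -, h⟩ := (whiten_posDef hX hC).1.exists_orthogonal_diagonal
  rw [isRelativeTrace_klReal X S C U z hX hS hC hCC hU h,
    isRelativeTrace_steinReal X S C U z hX hS hC hCC hU h]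
  refine Finset.sum_le_sum fun i _ => ?_
  have hz := whiten_eigenvalues_pos hX hC hU h i
  have := Real.log_le_sub_one_of_pos (inv_pos.2 hz)
  rw [Real.log_inv] at this
  linarith

lemma exists_coercive_bound {F : Matrix (Fin p) (Fin p) ℝ → ℝ} {S : Matrix (Fin p) (Fin p) ℝ}
    (hS : S.PosDef) {c b : ℝ} (hc : 0 < c)
    (hF : ∀ X : Matrix (Fin p) (Fin p) ℝ, X.PosDef → c * (S⁻¹ * X).trace - b ≤ F X) :
    ∃ h : ℝ → ℝ, Filter.Tendsto h Filter.atTop Filter.atTop ∧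
      ∀ X : Matrix (Fin p) (Fin p) ℝ, X.PosDef → h (frobNorm X) ≤ F X := by
  obtain ⟨k, hk, hkX⟩ := exists_pos_mul_trace_le hS.inv
  refine ⟨fun r => c * k * r + -b, Filter.tendsto_atTop_add_const_right _ _
    (Filter.tendsto_id.const_mul_atTop (mul_pos hc hk)), fun X hX => le_trans ?_ (hF X hX)⟩
  have h1 := (mul_le_mul_of_nonneg_left (frobNorm_le_trace hX.posSemidef) hk.le).trans
    (hkX X hX.posSemidef)
  nlinarith

open scoped Matrix.Norms.L2Operator in
lemma differentiableOn_klReal (S : Matrix (Fin p) (Fin p) ℝ) (hS : S.PosDef) :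
    DifferentiableOn ℝ (fun X => klReal X S) {X | X.PosDef} := by
  have h : DifferentiableOn ℝ (fun X : Matrix (Fin p) (Fin p) ℝ =>
      1 / 2 * ((S⁻¹ * X).trace - p + (Real.log S.det - Real.log X.det))) {X | X.PosDef} := by
    intro X hX
    have h1 := (differentiable_matrix_trace_mul S⁻¹).differentiableAt (x := X)
    have h2 := (differentiable_matrix_det.differentiableAt (x := X)).log hX.det_pos.ne'
    exact (((h1.sub_const _).add (h2.const_sub _)).const_mul _).differentiableWithinAt
  exact h.congr fun X hX => by rw [klReal, log_det_mul_inv_eq hX hS]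

open scoped Matrix.Norms.L2Operator in
lemma differentiableOn_steinReal (S : Matrix (Fin p) (Fin p) ℝ) :
    DifferentiableOn ℝ (fun X => steinReal X S) {X | X.PosDef} := by
  intro X hX
  have h1 := (differentiable_matrix_trace_mul S⁻¹).differentiableAt (x := X)
  have h2 := differentiableAt_trace_inv_mul S hX.isUnit
  exact (((h1.add h2).sub_const _).const_mul _).differentiableWithinAt

lemma klDivergence_of_posDef {X Y : Matrix (Fin p) (Fin p) ℝ} (hX : X.PosDef) (hY : Y.PosDef) :
    klDivergence X Y = klReal X Y := if_pos ⟨hX, hY⟩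

lemma steinDivergence_of_posDef {X Y : Matrix (Fin p) (Fin p) ℝ} (hX : X.PosDef)
    (hY : Y.PosDef) : steinDivergence X Y = steinReal X Y := if_pos ⟨hX, hY⟩

theorem isConvexDivergence_kl : IsConvexDivergence (klDivergence (p := p)) := by
  refine isConvexDivergence_of (P := PosDef) (Q := PosDef) (F := klReal)
    (fun X Y => klDivergence_of_posDef) (fun X Y h => if_neg h)
    (fun X Y => isRelativeTrace_klReal.nonneg fun z => sub_one_sub_log_nonneg)
    (fun X Y => isRelativeTrace_klReal.eq_zero_iff (fun z => sub_one_sub_log_nonneg)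
      fun z => sub_one_sub_log_eq_zero_iff)
    (fun S hS X Y hX hY t => isRelativeTrace_klReal.convex convexOn_sub_one_sub_log hS hX hY)
    (fun S hS => ?_) differentiableOn_klReal (fun S hS => ?_)
  · refine continuousOn_of_log_det_le
      (L := fun X => 1 / 2 * ((S⁻¹ * X).trace - p + Real.log S.det))
      (fun X hX => klDivergence_of_posDef hX hS) (fun X hX => if_neg fun h => hX h.1)
      (differentiableOn_klReal S hS).matrix_continuousOn (by fun_prop) fun X hX => ?_
    rw [klReal, log_det_mul_inv_eq hX hS]
    linarith
  -- From log(z/2) ≤ z/2 − 1 one gets ½(z − 1 − log z) ≥ z/4 − ½ log 2; the sum over eigenvalues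
  -- yields these constants.
  · refine exists_coercive_bound hS (c := 1 / 4) (b := 1 / 2 * ((p : ℝ) * Real.log 2)) (by norm_num)
      fun X hX => ?_
    obtain ⟨C, hC, hCC⟩ := exists_sqrt_inv hS
    obtain ⟨U, hU, z, -, h⟩ := (whiten_posDef hX hC).1.exists_orthogonal_diagonal
    rw [isRelativeTrace_klReal X S C U z hX hS hC hCC hU h, trace_inv_mul_eq_sum hCC hU h]
    have h1 : ∑ i, (1 / 4 * z i - 1 / 2 * Real.log 2) ≤ ∑ i, 1 / 2 * (z i - 1 - Real.log (z i)) := by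
      refine Finset.sum_le_sum fun i _ => ?_
      have hz := whiten_eigenvalues_pos hX hC hU h i
      have := Real.log_le_sub_one_of_pos (half_pos hz)
      rw [Real.log_div hz.ne' two_ne_zero] at this
      linarith
    rw [Finset.sum_sub_distrib, ← Finset.mul_sum] at h1
    simp only [Finset.sum_const, Finset.card_univ, Fintype.card_fin, nsmul_eq_mul] at h1
    linarith

theorem isConvexDivergence_stein : IsConvexDivergence (steinDivergence (p := p)) := by
  refine isConvexDivergence_of (P := PosDef) (Q := PosDef) (F := steinReal)
    (fun X Y => steinDivergence_of_posDef) (fun X Y h => if_neg h)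
    (fun X Y => isRelativeTrace_steinReal.nonneg fun z => add_inv_sub_two_nonneg)
    (fun X Y => isRelativeTrace_steinReal.eq_zero_iff (fun z => add_inv_sub_two_nonneg)
      fun z => add_inv_sub_two_eq_zero_iff)
    (fun S hS X Y hX hY t => isRelativeTrace_steinReal.convex convexOn_add_inv_sub_two hS hX hY)
    (fun S hS => ?_) (fun S _ => differentiableOn_steinReal S) (fun S hS => ?_)
  · refine continuousOn_of_log_det_le
      (L := fun X => 1 / 2 * ((S⁻¹ * X).trace - p + Real.log S.det))
      (fun X hX => steinDivergence_of_posDef hX hS) (fun X hX => if_neg fun h => hX h.1)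
      (differentiableOn_steinReal S).matrix_continuousOn (by fun_prop) fun X hX => ?_
    refine le_trans ?_ (klReal_le_steinReal hX hS)
    rw [klReal, log_det_mul_inv_eq hX hS]
    linarith
  -- The bound simply drops the nonnegative term ½ Tr(X⁻¹S).
  · refine exists_coercive_bound hS (c := 1 / 2) (b := p) (by norm_num) fun X hX => ?_
    have h := trace_mul_nonneg hX.inv.posSemidef hS.posSemidef
    rw [steinReal]
    linarith

lemma trace_inv_diagonal_mul_conj_le {x y : Fin p → ℝ} (hx : Monotone x) (hy : Monotone y)
    (hy0 : ∀ i, 0 < y i) {V : Matrix (Fin p) (Fin p) ℝ} (hV : V ∈ orthogonalGroup (Fin p) ℝ) :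
    ((diagonal y)⁻¹ * diagonal x).trace ≤ ((diagonal y)⁻¹ * (V * diagonal x * Vᵀ)).trace := by
  rw [inv_diagonal_of_ne_zero fun i => (hy0 i).ne', diagonal_mul_diagonal, trace_diagonal]
  exact sum_le_trace_diagonal_mul_conj hx (fun i j hij => inv_anti₀ (hy0 i) (hy hij)) hV

/-- The equality case is applied to the decreasing vector y⁻¹; a `W` fixing diag(y)⁻¹ under
conjugation also fixes its inverse. -/
lemma exists_of_trace_inv_diagonal_mul_conj_eq {x y : Fin p → ℝ} (hx : Monotone x)
    (hy : Monotone y) (hy0 : ∀ i, 0 < y i) {V : Matrix (Fin p) (Fin p) ℝ}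
    (hV : V ∈ orthogonalGroup (Fin p) ℝ)
    (h : ((diagonal y)⁻¹ * (V * diagonal x * Vᵀ)).trace = ((diagonal y)⁻¹ * diagonal x).trace) :
    ∃ W ∈ orthogonalGroup (Fin p) ℝ, W * diagonal y * Wᵀ = diagonal y ∧
      V * diagonal x * Vᵀ = W * diagonal x * Wᵀ := by
  have hinv := inv_diagonal_of_ne_zero fun i => (hy0 i).ne'
  rw [hinv, diagonal_mul_diagonal, trace_diagonal, trace_diagonal_mul_conj_eq_iff_of_antitone hx
    (fun i j hij => inv_anti₀ (hy0 i) (hy hij)) hV] at h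
  obtain ⟨W, hW, h1, h2⟩ := h
  refine ⟨W, hW, ?_, h2⟩
  rw [← hinv, ← inv_conj hW] at h1
  refine inv_inj h1 ?_
  rw [← isUnit_iff_isUnit_det]
  exact ((posDef_conj_diagonal hW).2 hy0).isUnit

/-- Cyclicity moves `V` from x to y as Vᵀ, exchanging the roles of the two vectors. -/
lemma trace_inv_mul_diagonal_le {x y : Fin p → ℝ} (hx : Monotone x) (hy : Monotone y)
    (hx0 : ∀ i, 0 < x i) {V : Matrix (Fin p) (Fin p) ℝ} (hV : V ∈ orthogonalGroup (Fin p) ℝ) :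
    ((diagonal x)⁻¹ * diagonal y).trace ≤ ((V * diagonal x * Vᵀ)⁻¹ * diagonal y).trace := by
  refine (trace_inv_diagonal_mul_conj_le hy hx hx0 (orthogonal_transpose_mem hV)).trans_eq ?_
  rw [inv_conj hV, transpose_transpose, ← Matrix.mul_assoc, ← Matrix.mul_assoc, trace_mul_comm]
  simp only [Matrix.mul_assoc]

/-- The determinant does not see the conjugation, so only the linear trace term changes. -/
lemma klReal_conj_sub (x y : Fin p → ℝ) {V : Matrix (Fin p) (Fin p) ℝ}
    (hV : V ∈ orthogonalGroup (Fin p) ℝ) :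
    klReal (V * diagonal x * Vᵀ) (diagonal y) - klReal (diagonal x) (diagonal y) =
      1 / 2 * (((diagonal y)⁻¹ * (V * diagonal x * Vᵀ)).trace -
        ((diagonal y)⁻¹ * diagonal x).trace) := by
  rw [klReal, klReal, inv_conj hV, det_mul, det_conj hV, ← det_mul]
  ring

theorem isSpectralDivergence_kl : IsSpectralDivergence (klDivergence (p := p)) klGenerator := by
  refine isSpectralDivergence_of (P := PosDef) (Q := PosDef) (F := klReal)
    (q := fun a => 0 < a) (r := fun b => 0 < b)
    (f := fun a b => 1 / 2 * (a / b - 1 - Real.log (a / b)))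
    (fun X Y => klDivergence_of_posDef) (fun X Y h => if_neg h)
    (fun a b ha hb => if_pos ⟨ha, hb⟩) (fun a b h => if_neg h)
    (fun V hV X => posDef_conj_iff hV) (fun V hV X => posDef_conj_iff hV)
    (fun x => posDef_diagonal) (fun x => posDef_diagonal) (fun V hV X Y _ _ => ?_)
    (fun a b ha hb => sub_one_sub_log_nonneg (div_pos ha hb)) (fun x y hx hy => ?_)
    (fun b hb => ?_) (fun x y hx hy hx0 hy0 V hV => ?_) (fun x y hx hy hx0 hy0 V hV h => ?_)
  · rw [klReal, klReal, inv_conj hV, inv_conj hV, conj_mul_conj hV, conj_mul_conj hV,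
      trace_conj hV, det_conj hV]
  · have hne : ∀ i, y i / x i ≠ 0 := fun i => (div_pos (hy i) (hx i)).ne'
    rw [klReal, inv_diagonal_of_ne_zero fun i => (hx i).ne',
      inv_diagonal_of_ne_zero fun i => (hy i).ne', diagonal_mul_diagonal, diagonal_mul_diagonal,
      trace_diagonal, det_diagonal]
    simp only [← div_eq_mul_inv, ← div_eq_inv_mul]
    rw [Real.log_prod fun i _ => hne i, ← Finset.mul_sum, Finset.sum_sub_distrib,
      Finset.sum_sub_distrib]
    have : ∀ i, Real.log (x i / y i) = -Real.log (y i / x i) := fun i => by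
      rw [← Real.log_inv, inv_div]
    simp [this]
  · refine contDiffOn_const.mul (((contDiffOn_id.div_const b).sub contDiffOn_const).sub
      ((contDiffOn_id.div_const b).log fun a ha => (div_pos ha hb).ne'))
  · have h1 := klReal_conj_sub x y hV
    have h2 := trace_inv_diagonal_mul_conj_le hx hy hy0 hV
    linarith
  · refine exists_of_trace_inv_diagonal_mul_conj_eq hx hy hy0 hV ?_
    have h1 := klReal_conj_sub x y hV
    linarith

theorem isSpectralDivergence_stein :
    IsSpectralDivergence (steinDivergence (p := p)) steinGenerator := by
  refine isSpectralDivergence_of (P := PosDef) (Q := PosDef) (F := steinReal)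
    (q := fun a => 0 < a) (r := fun b => 0 < b)
    (f := fun a b => 1 / 2 * (b / a + a / b - 2))
    (fun X Y => steinDivergence_of_posDef) (fun X Y h => if_neg h)
    (fun a b ha hb => if_pos ⟨ha, hb⟩) (fun a b h => if_neg h)
    (fun V hV X => posDef_conj_iff hV) (fun V hV X => posDef_conj_iff hV)
    (fun x => posDef_diagonal) (fun x => posDef_diagonal) (fun V hV X Y _ _ => ?_)
    (fun a b ha hb => ?_) (fun x y hx hy => ?_)
    (fun b hb => ?_) (fun x y hx hy hx0 hy0 V hV => ?_) (fun x y hx hy hx0 hy0 V hV h => ?_)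
  · rw [steinReal, steinReal, inv_conj hV, inv_conj hV, conj_mul_conj hV, conj_mul_conj hV,
      trace_conj hV, trace_conj hV]
  · simpa [inv_div, add_comm] using add_inv_sub_two_nonneg (div_pos ha hb)
  · rw [steinReal, inv_diagonal_of_ne_zero fun i => (hx i).ne',
      inv_diagonal_of_ne_zero fun i => (hy i).ne', diagonal_mul_diagonal, diagonal_mul_diagonal,
      trace_diagonal, trace_diagonal]
    simp only [← div_eq_inv_mul]
    rw [← Finset.mul_sum, Finset.sum_sub_distrib, Finset.sum_add_distrib]
    simp
    ring
  · exact contDiffOn_const.mul (((contDiffOn_const.div contDiffOn_id fun a ha =>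
      (Set.mem_Ioi.1 ha).ne').add (contDiffOn_id.div_const b)).sub contDiffOn_const)
  · have h1 := trace_inv_diagonal_mul_conj_le hx hy hy0 hV
    have h2 := trace_inv_mul_diagonal_le hx hy hx0 hV
    rw [steinReal, steinReal]
    linarith
  · have h1 := trace_inv_diagonal_mul_conj_le hx hy hy0 hV
    have h2 := trace_inv_mul_diagonal_le hx hy hx0 hV
    rw [steinReal, steinReal] at h
    -- Both traces are at least their sorted values, so equality of the sums forces equality in the
    -- first.
    exact exists_of_trace_inv_diagonal_mul_conj_eq hx hy hy0 hV (by linarith)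

end KullbackLeibler

/-! ### Squared and weighted Frobenius divergences. -/

section Frobenius

variable {p : ℕ} {A X Y S : Matrix (Fin p) (Fin p) ℝ}

lemma posSemidef_sub_sq (hX : X.IsHermitian) (hS : S.IsHermitian) : ((X - S) ^ 2).PosSemidef := by
  have h := posSemidef_conjTranspose_mul_self (X - S)
  rwa [(hX.sub hS).eq, ← sq] at h

lemma trace_sub_sq_mul_nonneg (hA : A.PosSemidef) (hX : X.IsHermitian) (hS : S.IsHermitian) :
    0 ≤ ((X - S) ^ 2 * A).trace :=
  trace_mul_nonneg (posSemidef_sub_sq hX hS) hA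

lemma trace_sub_sq_mul_eq_zero_iff (hA : A.PosDef) (hX : X.IsHermitian) (hS : S.IsHermitian) :
    ((X - S) ^ 2 * A).trace = 0 ↔ X = S := by
  constructor
  · intro h
    obtain ⟨c, hc, hcA⟩ := exists_pos_mul_trace_le hA
    have h1 := hcA _ (posSemidef_sub_sq hX hS)
    have h2 := (posSemidef_sub_sq hX hS).trace_nonneg
    rw [trace_mul_comm, h] at h1
    refine eq_of_trace_sub_mul_sub_eq_zero hX hS (le_antisymm ?_ ?_)
    · rw [← sq]
      exact nonpos_of_mul_nonpos_right h1 hc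
    · rwa [← sq]
  · rintro rfl
    simp

lemma trace_sub_sq_mul_convex (hA : A.PosSemidef) (hX : X.IsHermitian) (hY : Y.IsHermitian)
    {t : ℝ} (ht0 : 0 ≤ t) (ht1 : t ≤ 1) :
    ((t • X + (1 - t) • Y - S) ^ 2 * A).trace ≤
      t * ((X - S) ^ 2 * A).trace + (1 - t) * ((Y - S) ^ 2 * A).trace := by
  -- The convexity defect of the square is exactly t(1 − t)(X − Y)², whose trace against `A` is
  -- nonnegative.
  have key : (t • X + (1 - t) • Y - S) ^ 2 =
      t • (X - S) ^ 2 + (1 - t) • (Y - S) ^ 2 - (t * (1 - t)) • (X - Y) ^ 2 := by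
    have h : t • X + (1 - t) • Y - S = t • (X - S) + (1 - t) • (Y - S) := by module
    have h' : X - Y = (X - S) - (Y - S) := by abel
    rw [h, h']
    generalize X - S = M
    generalize Y - S = N
    simp only [sq, Matrix.add_mul, Matrix.mul_add, Matrix.sub_mul, Matrix.mul_sub,
      Matrix.smul_mul, Matrix.mul_smul]
    module
  have h1 := mul_nonneg (mul_nonneg ht0 (sub_nonneg.2 ht1)) (trace_sub_sq_mul_nonneg hA hX hY)
  rw [key]
  simp only [Matrix.sub_mul, Matrix.add_mul, smul_mul, trace_sub, trace_add, trace_smul,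
    smul_eq_mul]
  linarith

lemma trace_sub_sq_mul_coercive (hA : A.PosDef) (hS : S.IsHermitian) :
    ∃ h : ℝ → ℝ, Filter.Tendsto h Filter.atTop Filter.atTop ∧
      ∀ X : Matrix (Fin p) (Fin p) ℝ, X.PosSemidef →
        h (frobNorm X) ≤ ((X - S) ^ 2 * A).trace := by
  obtain ⟨c, hc, hcA⟩ := exists_pos_mul_trace_le hA
  refine ⟨fun r => c / 2 * r ^ 2 + -(c * (S ^ 2).trace),
    Filter.tendsto_atTop_add_const_right _ _
      ((Filter.tendsto_pow_atTop two_ne_zero).const_mul_atTop (half_pos hc)), fun X hX => ?_⟩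
  have h1 := hcA _ (posSemidef_sub_sq hX.1 hS)
  have h2 : 0 ≤ ((X - (2 : ℝ) • S) ^ 2).trace :=
    (posSemidef_sub_sq hX.1 (hS.smul (IsSelfAdjoint.all (2 : ℝ)))).trace_nonneg
  -- Dropping the last square after taking traces leaves ½‖X‖² − Tr S², with no cross term to
  -- estimate.
  have h3 : (X - S) ^ 2 = (1 / 2 : ℝ) • X ^ 2 - S ^ 2 + (1 / 2 : ℝ) • (X - (2 : ℝ) • S) ^ 2 := by
    simp only [sq, Matrix.sub_mul, Matrix.mul_sub, Matrix.smul_mul,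
      Matrix.mul_smul]
    module
  dsimp only
  rw [trace_mul_comm _ A, frobNorm_sq, isHermitian_iff_transpose.1 hX.1, ← sq]
  refine le_trans ?_ h1
  rw [h3, trace_add, trace_sub, trace_smul, trace_smul, smul_eq_mul, smul_eq_mul]
  nlinarith

lemma convexCombination_posSemidef (hX : X.PosSemidef) (hY : Y.PosSemidef) {t : ℝ} (ht0 : 0 ≤ t)
    (ht1 : t ≤ 1) : (t • X + (1 - t) • Y).PosSemidef :=
  (hX.smul ht0).add (hY.smul (sub_nonneg.2 ht1))

lemma continuous_trace_sub_sq_mul (S A : Matrix (Fin p) (Fin p) ℝ) :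
    Continuous fun X : Matrix (Fin p) (Fin p) ℝ => ((X - S) ^ 2 * A).trace := by
  fun_prop

/-- The weight `1` is kept explicit so that the lemmas on Tr((X − S)²A) serve both Frobenius
divergences. -/
lemma sqFrobeniusDivergence_of_posSemidef (hX : X.PosSemidef) (hY : Y.PosSemidef) :
    sqFrobeniusDivergence X Y = (((X - Y) ^ 2 * 1).trace : ℝ) := by
  rw [Matrix.mul_one]
  exact if_pos ⟨hX, hY⟩

lemma weightedFrobeniusDivergence_of_posSemidef (hX : X.PosSemidef) (hY : Y.PosDef) :
    weightedFrobeniusDivergence X Y = (((X - Y) ^ 2 * Y⁻¹).trace : ℝ) := if_pos ⟨hX, hY⟩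

theorem isConvexDivergence_sqFrobenius : IsConvexDivergence (sqFrobeniusDivergence (p := p)) :=
  isConvexDivergence_of (P := PosSemidef) (Q := PosSemidef)
    (F := fun X Y => ((X - Y) ^ 2 * 1).trace)
    (fun _ _ => sqFrobeniusDivergence_of_posSemidef) (fun _ _ h => if_neg h)
    (fun _ _ hX hY => trace_sub_sq_mul_nonneg PosSemidef.one hX.1 hY.1)
    (fun _ _ hX hY => trace_sub_sq_mul_eq_zero_iff PosDef.one hX.1 hY.1)
    (fun _ _ _ _ hX hY _ ht0 ht1 => ⟨convexCombination_posSemidef hX hY ht0 ht1,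
      trace_sub_sq_mul_convex PosSemidef.one hX.1 hY.1 ht0 ht1⟩)
    (fun S hS => (continuous_coe_real_ereal.comp
      (continuous_trace_sub_sq_mul S 1)).continuousOn.congr
        fun _ hX => sqFrobeniusDivergence_of_posSemidef hX hS)
    (fun S _ => (differentiable_trace_sub_sq_mul S 1).differentiableOn)
    (fun _ hS => trace_sub_sq_mul_coercive PosDef.one hS.1)

theorem isConvexDivergence_weightedFrobenius :
    IsConvexDivergence (weightedFrobeniusDivergence (p := p)) :=
  isConvexDivergence_of (P := PosSemidef) (Q := PosDef)
    (F := fun X Y => ((X - Y) ^ 2 * Y⁻¹).trace)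
    (fun _ _ => weightedFrobeniusDivergence_of_posSemidef) (fun _ _ h => if_neg h)
    (fun _ _ hX hY => trace_sub_sq_mul_nonneg hY.inv.posSemidef hX.1 hY.1)
    (fun _ _ hX hY => trace_sub_sq_mul_eq_zero_iff hY.inv hX.1 hY.1)
    (fun _ hS _ _ hX hY _ ht0 ht1 => ⟨convexCombination_posSemidef hX hY ht0 ht1,
      trace_sub_sq_mul_convex hS.inv.posSemidef hX.1 hY.1 ht0 ht1⟩)
    (fun S hS => (continuous_coe_real_ereal.comp
      (continuous_trace_sub_sq_mul S S⁻¹)).continuousOn.congr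
        fun _ hX => weightedFrobeniusDivergence_of_posSemidef hX hS)
    (fun S _ => (differentiable_trace_sub_sq_mul S S⁻¹).differentiableOn)
    (fun _ hS => trace_sub_sq_mul_coercive hS.inv hS.1)

lemma differentiableOn_sqFrobenius (hS : S.PosSemidef) :
    DifferentiableOn ℝ (fun X => (sqFrobeniusDivergence X S).toReal) {X | X.PosSemidef} :=
  (differentiable_trace_sub_sq_mul S 1).differentiableOn.congr fun X hX => by
    rw [sqFrobeniusDivergence_of_posSemidef hX hS, EReal.toReal_coe]

lemma differentiableOn_weightedFrobenius (hS : S.PosDef) :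
    DifferentiableOn ℝ (fun X => (weightedFrobeniusDivergence X S).toReal) {X | X.PosSemidef} :=
  (differentiable_trace_sub_sq_mul S S⁻¹).differentiableOn.congr fun X hX => by
    rw [weightedFrobeniusDivergence_of_posSemidef hX hS, EReal.toReal_coe]

lemma contDiffOn_sqFrobeniusGenerator {b : ℝ} (hb : 0 ≤ b) :
    ContDiffOn ℝ 2 (fun a => (sqFrobeniusGenerator a b).toReal) (Set.Ici 0) := by
  have h : ContDiffOn ℝ 2 (fun a : ℝ => (a - b) ^ 2) (Set.Ici 0) := by fun_prop
  refine h.congr fun a ha => ?_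
  rw [sqFrobeniusGenerator, if_pos ⟨ha, hb⟩, EReal.toReal_coe]

lemma contDiffOn_weightedFrobeniusGenerator {b : ℝ} (hb : 0 < b) :
    ContDiffOn ℝ 2 (fun a => (weightedFrobeniusGenerator a b).toReal) (Set.Ici 0) := by
  have h : ContDiffOn ℝ 2 (fun a : ℝ => (a - b) ^ 2 / b) (Set.Ici 0) := by fun_prop
  refine h.congr fun a ha => ?_
  rw [weightedFrobeniusGenerator, if_pos ⟨ha, hb⟩, EReal.toReal_coe]

lemma conj_sub_conj (V X Y : Matrix (Fin p) (Fin p) ℝ) :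
    V * X * Vᵀ - V * Y * Vᵀ = V * (X - Y) * Vᵀ := by
  rw [Matrix.mul_sub, Matrix.sub_mul]

lemma trace_sub_sq_conj (x y : Fin p → ℝ) {V : Matrix (Fin p) (Fin p) ℝ}
    (hV : V ∈ orthogonalGroup (Fin p) ℝ) :
    ((V * diagonal x * Vᵀ - diagonal y) ^ 2 * 1).trace =
      ∑ i, x i * x i + ∑ i, y i * y i - 2 * (diagonal y * (V * diagonal x * Vᵀ)).trace := by
  rw [Matrix.mul_one, sq, Matrix.sub_mul, Matrix.mul_sub, Matrix.mul_sub, trace_sub, trace_sub,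
    trace_sub, trace_sq_conj_diagonal hV, trace_mul_comm _ (diagonal y), diagonal_mul_diagonal,
    trace_diagonal]
  ring

/-- Only Tr(Y⁻¹X²) changes when X alone is conjugated, so rearrangement is the trace inequality for
x² and y⁻¹. -/
lemma trace_sub_sq_mul_inv (hY : Y.PosDef) :
    ((X - Y) ^ 2 * Y⁻¹).trace = (Y⁻¹ * (X * X)).trace - 2 * X.trace + Y.trace := by
  have hu := (isUnit_iff_isUnit_det _).1 hY.isUnit
  rw [sq, Matrix.sub_mul, Matrix.mul_sub, Matrix.mul_sub, Matrix.sub_mul, Matrix.sub_mul,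
    Matrix.sub_mul, mul_nonsing_inv_cancel_right _ _ hu, mul_nonsing_inv_cancel_right _ _ hu,
    trace_sub, trace_sub, trace_sub, trace_mul_comm (X * X), trace_mul_comm (Y * X),
    nonsing_inv_mul_cancel_left _ _ hu]
  ring

lemma trace_sub_sq_eq_sum (x y : Fin p → ℝ) :
    ((diagonal x - diagonal y) ^ 2 * 1).trace = ∑ i, (x i - y i) ^ 2 := by
  rw [Matrix.mul_one, diagonal_sub, diagonal_pow, trace_diagonal]
  rfl

theorem isSpectralDivergence_sqFrobenius :
    IsSpectralDivergence (sqFrobeniusDivergence (p := p)) sqFrobeniusGenerator := by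
  have key : ∀ x y : Fin p → ℝ, ((diagonal x - diagonal y) ^ 2 * 1).trace =
      ∑ i, x i * x i + ∑ i, y i * y i - 2 * ∑ i, y i * x i := by
    intro x y
    rw [trace_sub_sq_eq_sum, Finset.mul_sum, ← Finset.sum_add_distrib, ← Finset.sum_sub_distrib]
    exact Finset.sum_congr rfl fun i _ => by ring
  refine isSpectralDivergence_of (P := PosSemidef) (Q := PosSemidef)
    (F := fun X Y => ((X - Y) ^ 2 * 1).trace)
    (q := fun a => 0 ≤ a) (r := fun b => 0 ≤ b) (f := fun a b => (a - b) ^ 2)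
    (fun X Y => sqFrobeniusDivergence_of_posSemidef) (fun X Y h => if_neg h)
    (fun a b ha hb => if_pos ⟨ha, hb⟩) (fun a b h => if_neg h)
    (fun V hV X => posSemidef_conj_iff hV) (fun V hV X => posSemidef_conj_iff hV)
    (fun x => posSemidef_diagonal) (fun x => posSemidef_diagonal) (fun V hV X Y _ _ => ?_)
    (fun a b _ _ => sq_nonneg _) (fun x y _ _ => trace_sub_sq_eq_sum x y)
    (fun b hb => by fun_prop) (fun x y hx hy _ _ V hV => ?_) (fun x y hx hy _ _ V hV h => ?_)
  · rw [conj_sub_conj, sq, conj_mul_conj hV, Matrix.mul_one, trace_conj hV, Matrix.mul_one, sq]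
  · have := trace_diagonal_mul_conj_le hx hy hV
    rw [trace_sub_sq_conj x y hV, key]
    linarith
  · rw [trace_sub_sq_conj x y hV, key] at h
    exact (trace_diagonal_mul_conj_eq_iff hx hy hV).1 (by linarith)

theorem isSpectralDivergence_weightedFrobenius :
    IsSpectralDivergence (weightedFrobeniusDivergence (p := p)) weightedFrobeniusGenerator := by
  have hsq : ∀ {x : Fin p → ℝ}, Monotone x → (∀ i, 0 ≤ x i) → Monotone fun i => x i * x i :=
    fun hx hx0 i j hij => mul_self_le_mul_self (hx0 i) (hx hij)
  refine isSpectralDivergence_of (P := PosSemidef) (Q := PosDef)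
    (F := fun X Y => ((X - Y) ^ 2 * Y⁻¹).trace)
    (q := fun a => 0 ≤ a) (r := fun b => 0 < b) (f := fun a b => (a - b) ^ 2 / b)
    (fun X Y => weightedFrobeniusDivergence_of_posSemidef) (fun X Y h => if_neg h)
    (fun a b ha hb => if_pos ⟨ha, hb⟩) (fun a b h => if_neg h)
    (fun V hV X => posSemidef_conj_iff hV) (fun V hV X => posDef_conj_iff hV)
    (fun x => posSemidef_diagonal) (fun x => posDef_diagonal) (fun V hV X Y _ _ => ?_)
    (fun a b _ hb => by positivity) (fun x y hx hy => ?_)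
    (fun b hb => by fun_prop) (fun x y hx hy hx0 hy0 V hV => ?_)
    (fun x y hx hy hx0 hy0 V hV h => ?_)
  · rw [conj_sub_conj, sq, conj_mul_conj hV, inv_conj hV, conj_mul_conj hV, trace_conj hV, sq]
  · rw [inv_diagonal_of_ne_zero fun i => (hy i).ne', diagonal_sub, diagonal_pow,
      diagonal_mul_diagonal, trace_diagonal]
    rfl
  · have hY := posDef_diagonal.2 hy0
    have := trace_inv_diagonal_mul_conj_le (hsq hx hx0) hy hy0 hV
    simp only [trace_sub_sq_mul_inv hY]
    rw [conj_mul_conj hV, trace_conj hV, diagonal_mul_diagonal]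
    linarith
  · have hY := posDef_diagonal.2 hy0
    rw [trace_sub_sq_mul_inv hY, trace_sub_sq_mul_inv hY, conj_mul_conj hV, trace_conj hV,
      diagonal_mul_diagonal] at h
    obtain ⟨W, hW, h1, h2⟩ :=
      exists_of_trace_inv_diagonal_mul_conj_eq (hsq hx hx0) hy hy0 hV (by linarith)
    refine ⟨W, hW, h1, ?_⟩
    -- Equality was obtained for X²; positive semidefinite square roots bring it back to X.
    have h3 := congr_arg CFC.sqrt h2
    rw [sqrt_conj_diagonal hV fun i => mul_self_nonneg _,
      sqrt_conj_diagonal hW fun i => mul_self_nonneg _] at h3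
    simpa only [Real.sqrt_mul_self (hx0 _)] using h3

end Frobenius

/-! ### Singular values and the nuclear norm. -/

section SingularValues

variable {p : ℕ}

/-- Singular value decomposition of a square real matrix. -/
lemma exists_singular_value_decomposition (M : Matrix (Fin p) (Fin p) ℝ) :
    ∃ B ∈ orthogonalGroup (Fin p) ℝ, ∃ U ∈ orthogonalGroup (Fin p) ℝ, ∃ s : Fin p → ℝ,
      (∀ i, 0 ≤ s i) ∧ M = B * diagonal s * Uᵀ := by
  have hMM : (Mᵀ * M).PosSemidef := by simpa using posSemidef_conjTranspose_mul_self M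
  obtain ⟨U, hU, m, -, hm⟩ := hMM.1.exists_orthogonal_diagonal
  have hm0 : ∀ i, 0 ≤ m i := (posSemidef_conj_diagonal hU).1 (hm ▸ hMM)
  set N := M * U with hN
  have hNN : Nᵀ * N = diagonal m := by
    rw [hN, transpose_mul, (conj_eq_iff hU).1 hm.symm]
    simp only [Matrix.mul_assoc]
  have hcol : ∀ j k, ∑ i, N i j * N i k = diagonal m j k := by
    intro j k
    rw [← hNN, mul_apply]
    rfl
  -- These are the normalized columns of MU, which are orthogonal with squared lengths `m j`. Only
  -- those with `m j ≠ 0` are unit vectors; the rest of the basis comes from an extension.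
  let v : Fin p → EuclideanSpace ℝ (Fin p) := fun j => WithLp.toLp 2 fun i => (√(m j))⁻¹ * N i j
  have hv : Orthonormal ℝ (Set.domRestrict {j | m j ≠ 0} v) := by
    rw [orthonormal_iff_ite]
    rintro ⟨j, hj⟩ ⟨k, hk⟩
    have h1 : inner ℝ (v j) (v k) = (√(m j))⁻¹ * (√(m k))⁻¹ * diagonal m j k := by
      rw [← hcol, Finset.mul_sum, PiLp.inner_apply]
      refine Finset.sum_congr rfl fun i _ => ?_
      simp only [v, RCLike.inner_apply, conj_trivial]
      ring
    change inner ℝ (v j) (v k) = _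
    rw [h1]
    by_cases hjk : j = k
    · subst hjk
      have hs : √(m j) ≠ 0 := (Real.sqrt_pos.2 ((hm0 j).lt_of_ne' hj)).ne'
      rw [if_pos rfl, diagonal_apply_eq, ← Real.mul_self_sqrt (hm0 j)]
      simp only [Real.sqrt_mul_self (Real.sqrt_nonneg _)]
      field_simp
    · rw [diagonal_apply_ne _ hjk, mul_zero, if_neg (by simpa using hjk)]
  obtain ⟨b, hb⟩ := hv.exists_orthonormalBasis_extension_of_card_eq (by simp)
  let B : Matrix (Fin p) (Fin p) ℝ := of fun i j => b j i
  have hB : B ∈ orthogonalGroup (Fin p) ℝ := by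
    rw [mem_orthogonalGroup_iff_transpose_mul]
    ext j k
    have h := orthonormal_iff_ite.1 b.orthonormal j k
    rw [PiLp.inner_apply] at h
    rw [mul_apply, one_apply, ← h]
    refine Finset.sum_congr rfl fun i _ => ?_
    simp only [B, transpose_apply, of_apply, RCLike.inner_apply, conj_trivial]
    ring
  refine ⟨B, hB, U, hU, fun i => √(m i), fun i => Real.sqrt_nonneg _, ?_⟩
  have hNB : N = B * diagonal fun i => √(m i) := by
    ext i j
    rw [mul_diagonal]
    -- Where `m j = 0` the column of `N` itself vanishes, so the choice of the extra basis vector is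
    -- immaterial.
    by_cases hj : m j = 0
    · have h0 := hcol j j
      rw [diagonal_apply_eq, hj, Finset.sum_eq_zero_iff_of_nonneg fun i _ => mul_self_nonneg _] at h0
      rw [hj, Real.sqrt_zero, mul_zero]
      exact mul_self_eq_zero.1 (h0 i (Finset.mem_univ i))
    · have hs : √(m j) ≠ 0 := (Real.sqrt_pos.2 ((hm0 j).lt_of_ne' hj)).ne'
      simp only [B, of_apply, hb j hj, v]
      field_simp
  rw [← hNB, hN, Matrix.mul_assoc, orthogonal_mul_transpose hU, Matrix.mul_one]

lemma transpose_mul_self_of_svd {B U : Matrix (Fin p) (Fin p) ℝ}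
    (hB : B ∈ orthogonalGroup (Fin p) ℝ) (s : Fin p → ℝ) :
    (B * diagonal s * Uᵀ)ᵀ * (B * diagonal s * Uᵀ) = U * diagonal (fun i => s i * s i) * Uᵀ := by
  rw [transpose_mul, transpose_mul, transpose_transpose, diagonal_transpose, ← diagonal_mul_diagonal]
  simp only [Matrix.mul_assoc, orthogonal_cancel_left hB]

lemma trace_sqrt_transpose_mul_self {B U : Matrix (Fin p) (Fin p) ℝ}
    (hB : B ∈ orthogonalGroup (Fin p) ℝ) (hU : U ∈ orthogonalGroup (Fin p) ℝ) {s : Fin p → ℝ}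
    (hs : ∀ i, 0 ≤ s i) :
    (CFC.sqrt ((B * diagonal s * Uᵀ)ᵀ * (B * diagonal s * Uᵀ))).trace = ∑ i, s i := by
  rw [transpose_mul_self_of_svd hB, sqrt_conj_diagonal hU fun i => mul_self_nonneg _,
    trace_conj_diagonal hU]
  simp only [Real.sqrt_mul_self (hs _)]

/-- The nuclear norm is attained by pairing with an orthogonal matrix. -/
lemma exists_orthogonal_trace_mul_eq (M : Matrix (Fin p) (Fin p) ℝ) :
    ∃ Q ∈ orthogonalGroup (Fin p) ℝ, (CFC.sqrt (Mᵀ * M)).trace = (Q * M).trace := by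
  obtain ⟨B, hB, U, hU, s, hs, rfl⟩ := exists_singular_value_decomposition M
  refine ⟨U * Bᵀ, mul_mem hU (orthogonal_transpose_mem hB), ?_⟩
  rw [trace_sqrt_transpose_mul_self hB hU hs, ← trace_conj_diagonal hU]
  simp only [Matrix.mul_assoc, orthogonal_cancel_left hB]

/-- Transposing a singular value decomposition swaps the two orthogonal factors and keeps the
singular values. -/
lemma trace_sqrt_transpose_mul_self_comm (M : Matrix (Fin p) (Fin p) ℝ) :
    (CFC.sqrt (Mᵀ * M)).trace = (CFC.sqrt (M * Mᵀ)).trace := by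
  obtain ⟨B, hB, U, hU, s, hs, rfl⟩ := exists_singular_value_decomposition M
  have h := trace_sqrt_transpose_mul_self (B := U) (U := B) hU hB hs
  rw [trace_sqrt_transpose_mul_self hB hU hs, ← h]
  simp [Matrix.mul_assoc]

end SingularValues

/-! ### Differentiability of the matrix square root. -/

section SqrtCalculus

variable {p : ℕ}

/-- Multiplying by Hᵀ and taking the trace gives two nonnegative terms with sum zero, the first at
least c‖H‖². This makes the derivative of squaring injective. -/
lemma eq_zero_of_mul_add_mul_eq_zero {Y H : Matrix (Fin p) (Fin p) ℝ} (hY : Y.PosDef)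
    (h : Y * H + H * Y = 0) : H = 0 := by
  obtain ⟨c, hc, hcY⟩ := exists_pos_mul_trace_le hY
  have h1 : (H * Hᴴ).PosSemidef := posSemidef_self_mul_conjTranspose H
  have h2 : (Hᴴ * H).PosSemidef := posSemidef_conjTranspose_mul_self H
  have h3 : (Y * (H * Hᴴ)).trace + (Y * (Hᴴ * H)).trace = 0 := by
    have := congr_arg (fun Z => (Z * Hᴴ).trace) h
    simp only [Matrix.add_mul, trace_add, Matrix.zero_mul, trace_zero] at this
    rw [← this, Matrix.mul_assoc Y, Matrix.mul_assoc H, trace_mul_comm H, Matrix.mul_assoc]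
  have h4 := hcY _ h1
  have h5 := trace_mul_nonneg hY.posSemidef h2
  have h6 := h1.trace_nonneg
  rw [← trace_mul_conjTranspose_self_eq_zero_iff]
  nlinarith

open scoped Matrix.Norms.L2Operator in
-- Squaring has the derivative H ↦ YH + HY at Y = √A, invertible by injectivity in finite dimension.
-- The root is a continuous right inverse of squaring, hence differentiable.
lemma differentiableWithinAt_sqrt {A : Matrix (Fin p) (Fin p) ℝ} (hA : A.PosDef) :
    DifferentiableWithinAt ℝ (CFC.sqrt : Matrix (Fin p) (Fin p) ℝ → _) {X | X.PosDef} A := by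
  set Y := CFC.sqrt A with hY
  let L : Matrix (Fin p) (Fin p) ℝ →ₗ[ℝ] Matrix (Fin p) (Fin p) ℝ :=
    LinearMap.mulLeft ℝ Y + LinearMap.mulRight ℝ Y
  have hL : Function.Injective L := by
    rw [← LinearMap.ker_eq_bot, LinearMap.ker_eq_bot']
    exact fun H hH => eq_zero_of_mul_add_mul_eq_zero (sqrt_posDef hA) hH
  let e := (LinearEquiv.ofInjectiveEndo L hL).toContinuousLinearEquiv
  have hf : HasFDerivAt (fun Z : Matrix (Fin p) (Fin p) ℝ => Z * Z)
      (e : Matrix (Fin p) (Fin p) ℝ →L[ℝ] Matrix (Fin p) (Fin p) ℝ) Y := by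
    have h := (hasFDerivAt_id (𝕜 := ℝ) Y).mul' (hasFDerivAt_id (𝕜 := ℝ) Y)
    refine h.congr_fderiv ?_
    ext1 H
    simp [e, L]
  have hcont : Filter.Tendsto (CFC.sqrt : Matrix (Fin p) (Fin p) ℝ → _)
      (nhdsWithin A {X | X.PosDef}) (nhdsWithin (CFC.sqrt A) Set.univ) := by
    rw [nhdsWithin_univ]
    exact (continuousOn_matrix_sqrt A hA.posSemidef).mono fun X hX => PosDef.posSemidef hX
  exact (HasFDerivWithinAt.of_local_left_inverse hcont hf.hasFDerivWithinAt hA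
    (Filter.eventually_of_mem self_mem_nhdsWithin fun X hX =>
      sqrt_mul_sqrt_of_posSemidef (PosDef.posSemidef hX))).differentiableWithinAt

open scoped Matrix.Norms.L2Operator in
/-- The trace of `(C X C)^{1/2}` is differentiable at positive definite `X`, also when `C` is
singular: the orthogonal projection on the kernel of `C` makes `C X C` positive definite. -/
lemma differentiableOn_trace_sqrt_conj {C : Matrix (Fin p) (Fin p) ℝ} (hC : C.PosSemidef) :
    DifferentiableOn ℝ (fun X => (CFC.sqrt (C * X * C)).trace) {X | X.PosDef} := by
  obtain ⟨U, hU, c, -, hCU⟩ := hC.1.exists_orthogonal_diagonal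
  set P := U * diagonal (fun i => if c i = 0 then (1 : ℝ) else 0) * Uᵀ with hP
  have hPpsd : P.PosSemidef := (posSemidef_conj_diagonal hU).2 fun i => by split_ifs <;> simp
  clear_value P
  have hPP : P * P = P := by
    rw [hP, conj_mul_conj hU, diagonal_mul_diagonal]
    congr
    ext i
    split_ifs <;> simp
  have hCP : C * P = 0 := by
    have h : (fun i => c i * if c i = 0 then (1 : ℝ) else 0) = fun _ => 0 := by
      ext i
      split_ifs with h <;> simp [h]
    rw [hP, hCU, conj_mul_conj hU, diagonal_mul_diagonal, h]
    simp
  have hCXC : ∀ {X : Matrix (Fin p) (Fin p) ℝ}, X.PosSemidef → (C * X * C).PosSemidef := by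
    intro X hX
    have := hX.mul_mul_conjTranspose_same C
    rwa [hC.1] at this
  -- R = √(CXC) and the projection `P` annihilate each other, since CP = 0 makes ‖RP‖² = Tr(P·CXC·P)
  -- vanish. So R + P squares to CXC + P, and the trace of the root shifts by a constant.
  have hsqrt : ∀ X : Matrix (Fin p) (Fin p) ℝ, X.PosDef →
      CFC.sqrt (C * X * C + P) = CFC.sqrt (C * X * C) + P := by
    intro X hX
    set R := CFC.sqrt (C * X * C) with hR
    have hRR : R * R = C * X * C := sqrt_mul_sqrt_of_posSemidef (hCXC hX.posSemidef)
    have hRt : Rᵀ = R := sqrt_transpose _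
    have hPt : Pᵀ = P := isHermitian_iff_transpose.1 hPpsd.1
    have hRP : R * P = 0 := by
      rw [← trace_conjTranspose_mul_self_eq_zero_iff, conjTranspose_eq_transpose_of_trivial,
        transpose_mul, hRt, hPt, Matrix.mul_assoc, ← Matrix.mul_assoc R, hRR, Matrix.mul_assoc,
        hCP]
      simp
    have hPR : P * R = 0 := by
      rw [← hRt, ← hPt, ← transpose_mul, hRP, transpose_zero]
    refine sqrt_eq_of_mul_self ((sqrt_posSemidef _).add hPpsd) ?_
    rw [Matrix.add_mul, Matrix.mul_add, Matrix.mul_add, hRR, hRP, hPR, hPP]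
    simp
  have hpd : ∀ X : Matrix (Fin p) (Fin p) ℝ, X.PosDef → (C * X * C + P).PosDef := by
    intro X hX
    refine PosDef.of_dotProduct_mulVec_pos ((hCXC hX.posSemidef).add hPpsd).1 fun v hv => ?_
    have h1 := (hCXC hX.posSemidef).dotProduct_mulVec_nonneg v
    have h2 := hPpsd.dotProduct_mulVec_nonneg v
    rw [add_mulVec, dotProduct_add]
    refine (add_nonneg h1 h2).lt_of_ne' fun h0 => hv ?_
    have h3 : star v ⬝ᵥ (C * X * C) *ᵥ v = 0 := by linarith
    have h4 : star v ⬝ᵥ P *ᵥ v = 0 := by linarith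
    rw [hPpsd.dotProduct_mulVec_zero_iff] at h4
    have hCv : C *ᵥ v = 0 := by
      by_contra hne
      have h5 := hX.dotProduct_mulVec_pos hne
      rw [star_mulVec, hC.1, ← dotProduct_mulVec, mulVec_mulVec, mulVec_mulVec, h3] at h5
      exact lt_irrefl _ h5
    -- Adding `P` replaces the zero eigenvalues of `C` by 1, so a vector killed by both `C` and `P`
    -- is zero.
    have hK : U * diagonal (fun i => c i + if c i = 0 then (1 : ℝ) else 0) * Uᵀ = C + P := by
      rw [hP, hCU, ← diagonal_add, Matrix.mul_add, Matrix.add_mul]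
    have hunit : IsUnit (C + P) := by
      rw [← hK]
      refine ((posDef_conj_diagonal hU).2 fun i => ?_).isUnit
      have hci : 0 ≤ c i := (posSemidef_conj_diagonal hU).1 (hCU ▸ hC) i
      split_ifs with h
      · simp [h]
      · simpa using hci.lt_of_ne' h
    refine (mulVec_injective_iff_isUnit.2 hunit) ?_
    rw [add_mulVec, hCv, h4, mulVec_zero, add_zero]
  have haff : Differentiable ℝ fun X : Matrix (Fin p) (Fin p) ℝ => C * X * C + P := by fun_prop
  have h : DifferentiableOn ℝ
      (fun X : Matrix (Fin p) (Fin p) ℝ => (1 * CFC.sqrt (C * X * C + P)).trace - P.trace)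
      {X | X.PosDef} := by
    intro X hX
    have h1 : DifferentiableWithinAt ℝ (fun X => CFC.sqrt (C * X * C + P)) {X | X.PosDef} X :=
      (differentiableWithinAt_sqrt (hpd X hX)).comp (t := {X | X.PosDef}) X
        haff.differentiableAt.differentiableWithinAt hpd
    exact ((differentiable_matrix_trace_mul 1).differentiableAt.comp_differentiableWithinAt X
      h1).sub_const _
  refine h.congr fun X hX => ?_
  rw [hsqrt X hX, Matrix.one_mul, trace_add, add_sub_cancel_right]

end SqrtCalculus

/-! ### The Wasserstein divergence. -/

section Wasserstein

variable {p : ℕ} {X Y S : Matrix (Fin p) (Fin p) ℝ}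

/-- The real-valued Wasserstein divergence of positive semidefinite matrices. -/
noncomputable def wassersteinReal (X Y : Matrix (Fin p) (Fin p) ℝ) : ℝ :=
  (X + Y - (2 : ℝ) • CFC.sqrt (CFC.sqrt X * Y * CFC.sqrt X)).trace

lemma wassersteinReal_eq (X Y : Matrix (Fin p) (Fin p) ℝ) :
    wassersteinReal X Y =
      X.trace + Y.trace - 2 * (CFC.sqrt (CFC.sqrt X * Y * CFC.sqrt X)).trace := by
  rw [wassersteinReal, trace_sub, trace_add, trace_smul, smul_eq_mul]

lemma wassersteinDivergence_of_posSemidef (hX : X.PosSemidef) (hY : Y.PosSemidef) :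
    wassersteinDivergence X Y = wassersteinReal X Y := if_pos ⟨hX, hY⟩

/-- This exhibits the trace of the root as the nuclear norm of √S√X. -/
lemma sqrt_mul_mul_sqrt_eq (hS : S.PosSemidef) :
    CFC.sqrt X * S * CFC.sqrt X = (CFC.sqrt S * CFC.sqrt X)ᵀ * (CFC.sqrt S * CFC.sqrt X) := by
  rw [transpose_mul, sqrt_transpose, sqrt_transpose, Matrix.mul_assoc, Matrix.mul_assoc,
    ← Matrix.mul_assoc (CFC.sqrt S), sqrt_mul_sqrt_of_posSemidef hS]

lemma sqrt_mul_mul_sqrt_posSemidef (hS : S.PosSemidef) :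
    (CFC.sqrt X * S * CFC.sqrt X).PosSemidef := by
  have h := hS.mul_mul_conjTranspose_same (CFC.sqrt X)
  rwa [(sqrt_posSemidef X).1] at h

lemma exists_orthogonal_trace_sqrt_eq (hS : S.PosSemidef) :
    ∃ Q ∈ orthogonalGroup (Fin p) ℝ,
      (CFC.sqrt (CFC.sqrt X * S * CFC.sqrt X)).trace = (Q * (CFC.sqrt S * CFC.sqrt X)).trace := by
  rw [sqrt_mul_mul_sqrt_eq hS]
  exact exists_orthogonal_trace_mul_eq _

/-- √S√X and its transpose have the same nuclear norm. On the right X enters linearly under the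
root, as concavity and differentiability in X require. -/
lemma trace_sqrt_comm (hX : X.PosSemidef) (hS : S.PosSemidef) :
    (CFC.sqrt (CFC.sqrt X * S * CFC.sqrt X)).trace =
      (CFC.sqrt (CFC.sqrt S * X * CFC.sqrt S)).trace := by
  rw [sqrt_mul_mul_sqrt_eq hS, sqrt_mul_mul_sqrt_eq hX, trace_sqrt_transpose_mul_self_comm]
  simp [sqrt_transpose]

/-- For c = 1 and the optimal `Q` the right-hand side is the divergence itself; c = 2 serves
coercivity. -/
lemma trace_transpose_mul_self_sub (hX : X.PosSemidef) (hS : S.PosSemidef) (c : ℝ)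
    {Q : Matrix (Fin p) (Fin p) ℝ} (hQ : Q ∈ orthogonalGroup (Fin p) ℝ) :
    ((CFC.sqrt X * Q - c • CFC.sqrt S)ᴴ * (CFC.sqrt X * Q - c • CFC.sqrt S)).trace =
      X.trace + c ^ 2 * S.trace - 2 * c * (Q * (CFC.sqrt S * CFC.sqrt X)).trace := by
  have h1 : (Qᵀ * CFC.sqrt X * (CFC.sqrt X * Q)).trace = X.trace := by
    rw [Matrix.mul_assoc, ← Matrix.mul_assoc (CFC.sqrt X), sqrt_mul_sqrt_of_posSemidef hX,
      trace_mul_comm, Matrix.mul_assoc, orthogonal_mul_transpose hQ, Matrix.mul_one]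
  have h2 : (CFC.sqrt S * (CFC.sqrt X * Q)).trace = (Q * (CFC.sqrt S * CFC.sqrt X)).trace := by
    rw [← Matrix.mul_assoc, trace_mul_comm]
  have h3 : (Qᵀ * CFC.sqrt X * CFC.sqrt S).trace = (Q * (CFC.sqrt S * CFC.sqrt X)).trace := by
    rw [← h2, ← trace_transpose, transpose_mul, transpose_mul, transpose_transpose, sqrt_transpose,
      sqrt_transpose]
  rw [conjTranspose_eq_transpose_of_trivial, transpose_sub, transpose_mul, transpose_smul,
    sqrt_transpose, sqrt_transpose, Matrix.sub_mul, Matrix.mul_sub, Matrix.mul_sub]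
  simp only [Matrix.smul_mul, Matrix.mul_smul, trace_sub, trace_smul, smul_eq_mul]
  rw [h1, h2, h3, sqrt_mul_sqrt_of_posSemidef hS]
  ring

lemma two_mul_trace_sqrt_le (hX : X.PosSemidef) (hS : S.PosSemidef) (c : ℝ) :
    2 * c * (CFC.sqrt (CFC.sqrt X * S * CFC.sqrt X)).trace ≤ X.trace + c ^ 2 * S.trace := by
  obtain ⟨Q, hQ, h⟩ := exists_orthogonal_trace_sqrt_eq (X := X) hS
  have h1 := trace_transpose_mul_self_sub hX hS c hQ
  have h2 := (posSemidef_conjTranspose_mul_self (CFC.sqrt X * Q - c • CFC.sqrt S)).trace_nonneg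
  rw [h]
  linarith

lemma wassersteinReal_nonneg (hX : X.PosSemidef) (hS : S.PosSemidef) : 0 ≤ wassersteinReal X S := by
  have := two_mul_trace_sqrt_le hX hS 1
  rw [wassersteinReal_eq]
  linarith

lemma wassersteinReal_eq_zero_iff (hX : X.PosSemidef) (hS : S.PosSemidef) :
    wassersteinReal X S = 0 ↔ X = S := by
  rw [wassersteinReal_eq]
  constructor
  · intro h0
    obtain ⟨Q, hQ, h⟩ := exists_orthogonal_trace_sqrt_eq (X := X) hS
    have h1 := trace_transpose_mul_self_sub hX hS 1 hQ
    have h2 : CFC.sqrt X * Q = CFC.sqrt S := by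
      rw [← sub_eq_zero, ← one_smul ℝ (CFC.sqrt S), ← trace_conjTranspose_mul_self_eq_zero_iff, h1,
        ← h]
      linarith
    calc X = CFC.sqrt X * Q * (CFC.sqrt X * Q)ᵀ := by
          rw [transpose_mul, sqrt_transpose, Matrix.mul_assoc, orthogonal_cancel_left' hQ,
            sqrt_mul_sqrt_of_posSemidef hX]
      _ = S := by rw [h2, sqrt_transpose, sqrt_mul_sqrt_of_posSemidef hS]
  · rintro rfl
    have h : CFC.sqrt X * X * CFC.sqrt X = X * X := by
      have hR := sqrt_mul_sqrt_of_posSemidef hX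
      calc CFC.sqrt X * X * CFC.sqrt X = CFC.sqrt X * (CFC.sqrt X * CFC.sqrt X) * CFC.sqrt X := by
            rw [hR]
        _ = CFC.sqrt X * CFC.sqrt X * (CFC.sqrt X * CFC.sqrt X) := by simp only [Matrix.mul_assoc]
        _ = X * X := by rw [hR]
    rw [h, sqrt_eq_of_mul_self hX rfl]
    ring

/-- The trace function of the convex function −√ is applied after the linear map X ↦ √S X √S. -/
lemma concaveOn_trace_sqrt_conj (hX : X.PosSemidef) (hY : Y.PosSemidef)
    {t : ℝ} (ht0 : 0 ≤ t) (ht1 : t ≤ 1) :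
    t * (CFC.sqrt (CFC.sqrt S * X * CFC.sqrt S)).trace +
        (1 - t) * (CFC.sqrt (CFC.sqrt S * Y * CFC.sqrt S)).trace ≤
      (CFC.sqrt (CFC.sqrt S * (t • X + (1 - t) • Y) * CFC.sqrt S)).trace := by
  have hX' := sqrt_mul_mul_sqrt_posSemidef (X := S) hX
  have hY' := sqrt_mul_mul_sqrt_posSemidef (X := S) hY
  have hZ' := sqrt_mul_mul_sqrt_posSemidef (X := S) (convexCombination_posSemidef hX hY ht0 ht1)
  obtain ⟨U, hU, a, -, ha⟩ := hX'.1.exists_orthogonal_diagonal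
  obtain ⟨V, hV, b, -, hb⟩ := hY'.1.exists_orthogonal_diagonal
  obtain ⟨W, hW, c, -, hc⟩ := hZ'.1.exists_orthogonal_diagonal
  rw [ha, posSemidef_conj_diagonal hU] at hX'
  rw [hb, posSemidef_conj_diagonal hV] at hY'
  rw [hc, posSemidef_conj_diagonal hW] at hZ'
  have key := sum_map_eigenvalues_convex Real.strictConcaveOn_sqrt.concaveOn.neg hU hV hW hX' hY'
    ht0 ht1 (c := c) <| by
      rw [← ha, ← hb, ← hc]
      simp [Matrix.mul_add, Matrix.add_mul]
  rw [ha, hb, hc, sqrt_conj_diagonal hU hX', sqrt_conj_diagonal hV hY', sqrt_conj_diagonal hW hZ',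
    trace_conj_diagonal hU, trace_conj_diagonal hV, trace_conj_diagonal hW]
  simp only [Pi.neg_apply, Finset.sum_neg_distrib] at key
  linarith

lemma continuousOn_wassersteinReal (hS : S.PosSemidef) :
    ContinuousOn (fun X => wassersteinReal X S) {X | X.PosSemidef} := by
  have h1 := continuousOn_matrix_sqrt (n := Fin p)
  have h2 : ContinuousOn (fun X : Matrix (Fin p) (Fin p) ℝ =>
      CFC.sqrt (CFC.sqrt X * S * CFC.sqrt X)) {X | X.PosSemidef} :=
    continuousOn_matrix_sqrt.comp ((h1.mul continuousOn_const).mul h1)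
      fun X _ => sqrt_mul_mul_sqrt_posSemidef hS
  have htr : Continuous fun X : Matrix (Fin p) (Fin p) ℝ => X.trace := by fun_prop
  exact htr.comp_continuousOn (((continuousOn_id.add continuousOn_const)).sub
    (h2.const_smul (2 : ℝ)))

open scoped Matrix.Norms.L2Operator in
lemma differentiableOn_wassersteinReal (hS : S.PosSemidef) :
    DifferentiableOn ℝ (fun X => wassersteinReal X S) {X | X.PosDef} := by
  have h : DifferentiableOn ℝ (fun X : Matrix (Fin p) (Fin p) ℝ => (1 * X).trace + S.trace -
      2 * (CFC.sqrt (CFC.sqrt S * X * CFC.sqrt S)).trace) {X | X.PosDef} :=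
    ((differentiable_matrix_trace_mul 1).differentiableOn.add_const _).sub
      ((differentiableOn_trace_sqrt_conj (sqrt_posSemidef S)).const_mul 2)
  refine h.congr fun X hX => ?_
  rw [wassersteinReal_eq, trace_sqrt_comm (PosDef.posSemidef hX) hS, Matrix.one_mul]

theorem isConvexDivergence_wasserstein : IsConvexDivergence (wassersteinDivergence (p := p)) := by
  refine isConvexDivergence_of (P := PosSemidef) (Q := PosSemidef) (F := wassersteinReal)
    (fun _ _ => wassersteinDivergence_of_posSemidef) (fun _ _ h => if_neg h)
    (fun _ _ => wassersteinReal_nonneg) (fun _ _ => wassersteinReal_eq_zero_iff)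
    (fun S hS X Y hX hY t ht0 ht1 => ⟨convexCombination_posSemidef hX hY ht0 ht1, ?_⟩)
    (fun S hS => (continuous_coe_real_ereal.comp_continuousOn
      (continuousOn_wassersteinReal hS)).congr
        fun X hX => wassersteinDivergence_of_posSemidef hX hS)
    (fun S hS => differentiableOn_wassersteinReal hS) (fun S hS => ?_)
  · have h := concaveOn_trace_sqrt_conj (S := S) hX hY ht0 ht1
    rw [wassersteinReal_eq, wassersteinReal_eq, wassersteinReal_eq, trace_sqrt_comm hX hS,
      trace_sqrt_comm hY hS, trace_sqrt_comm (convexCombination_posSemidef hX hY ht0 ht1) hS,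
      trace_add, trace_smul, trace_smul, smul_eq_mul, smul_eq_mul]
    linarith
  · refine ⟨fun r => 1 / 2 * r + -S.trace, Filter.tendsto_atTop_add_const_right _ _
      (Filter.tendsto_id.const_mul_atTop (by norm_num)), fun X hX => ?_⟩
    -- The choice c = 2 absorbs only half of Tr X, leaving ½ Tr X − Tr S as a lower bound.
    have h1 := two_mul_trace_sqrt_le hX hS 2
    have h2 := frobNorm_le_trace hX
    rw [wassersteinReal_eq]
    linarith

lemma wassersteinReal_diagonal {x y : Fin p → ℝ} (hx : ∀ i, 0 ≤ x i) (hy : ∀ i, 0 ≤ y i) :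
    wassersteinReal (diagonal x) (diagonal y) = ∑ i, (x i + y i - 2 * √(x i * y i)) := by
  have h : ∀ i, √(x i) * y i * √(x i) = x i * y i := fun i => by
    rw [mul_right_comm, Real.mul_self_sqrt (hx i)]
  rw [wassersteinReal_eq, sqrt_diagonal hx, diagonal_mul_diagonal, diagonal_mul_diagonal]
  simp only [h]
  rw [sqrt_diagonal fun i => mul_nonneg (hx i) (hy i), trace_diagonal, trace_diagonal,
    trace_diagonal, Finset.sum_sub_distrib, Finset.sum_add_distrib, Finset.mul_sum]

/-- With R = QᵀV the left side is Σ 2 RᵢⱼVᵢⱼ yᵢxⱼ. Bounding 2RV by R² + V² separates two von Neumann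
traces; the one in R is at most its sorted value, the one in V is kept. -/
lemma trace_orthogonal_mul_le {x y : Fin p → ℝ} (hx : Monotone x) (hy : Monotone y)
    (hx0 : ∀ i, 0 ≤ x i) (hy0 : ∀ i, 0 ≤ y i) {Q V : Matrix (Fin p) (Fin p) ℝ}
    (hQ : Q ∈ orthogonalGroup (Fin p) ℝ) (hV : V ∈ orthogonalGroup (Fin p) ℝ) :
    2 * (Q * (diagonal y * (V * diagonal x * Vᵀ))).trace ≤
      ∑ i, y i * x i + (diagonal y * (V * diagonal x * Vᵀ)).trace := by
  have hR : Qᵀ * V ∈ orthogonalGroup (Fin p) ℝ := mul_mem (orthogonal_transpose_mem hQ) hV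
  set R := Qᵀ * V with hRdef
  have h1 : (Q * (diagonal y * (V * diagonal x * Vᵀ))).trace =
      ∑ i, ∑ j, R i j * V i j * (y i * x j) := by
    have : (Q * (diagonal y * (V * diagonal x * Vᵀ))).trace =
        (diagonal y * (V * diagonal x * Rᵀ)).trace := by
      rw [trace_mul_comm, hRdef, transpose_mul, transpose_transpose]
      simp only [Matrix.mul_assoc]
    rw [this, trace]
    refine Finset.sum_congr rfl fun i _ => ?_
    rw [diag_apply, diagonal_mul, mul_apply, Finset.mul_sum]
    refine Finset.sum_congr rfl fun j _ => ?_
    rw [mul_diagonal, transpose_apply]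
    ring
  have h2 := trace_diagonal_mul_conj_le hx hy hR
  refine le_trans ?_ (add_le_add_left h2 _)
  rw [h1, trace_diagonal_mul_conj, trace_diagonal_mul_conj, Finset.mul_sum,
    ← Finset.sum_add_distrib]
  refine Finset.sum_le_sum fun i _ => ?_
  rw [Finset.mul_sum, ← Finset.sum_add_distrib]
  refine Finset.sum_le_sum fun j _ => ?_
  have := mul_nonneg (sq_nonneg (R i j - V i j)) (mul_nonneg (hy0 i) (hx0 j))
  linarith

lemma conj_diagonal_mul_self_eq {x : Fin p → ℝ} (hx : ∀ i, 0 ≤ x i)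
    {V : Matrix (Fin p) (Fin p) ℝ} (hV : V ∈ orthogonalGroup (Fin p) ℝ) :
    (V * (diagonal fun i => √(x i)) * Vᵀ) * (V * (diagonal fun i => √(x i)) * Vᵀ) =
      V * diagonal x * Vᵀ := by
  rw [conj_mul_conj hV, diagonal_mul_diagonal]
  simp only [Real.mul_self_sqrt (hx _)]

theorem isSpectralDivergence_wasserstein :
    IsSpectralDivergence (wassersteinDivergence (p := p)) wassersteinGenerator := by
  have hmono : ∀ {x : Fin p → ℝ}, Monotone x → Monotone fun i => √(x i) :=
    fun hx i j hij => Real.sqrt_le_sqrt (hx hij)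
  -- The added bracket is the von Neumann deficit of √x and √y. It is nonnegative, and equality of
  -- the divergences forces it to vanish.
  have key : ∀ x y : Fin p → ℝ, Monotone x → Monotone y → (∀ i, 0 ≤ x i) → (∀ i, 0 ≤ y i) →
      ∀ V ∈ orthogonalGroup (Fin p) ℝ,
        wassersteinReal (diagonal x) (diagonal y) + (∑ i, √(y i) * √(x i) -
          ((diagonal fun i => √(y i)) * (V * (diagonal fun i => √(x i)) * Vᵀ)).trace) ≤
        wassersteinReal (V * diagonal x * Vᵀ) (diagonal y) := by
    intro x y hx hy hx0 hy0 V hV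
    obtain ⟨Q, hQ, h⟩ := exists_orthogonal_trace_sqrt_eq (X := V * diagonal x * Vᵀ)
      (posSemidef_diagonal.2 hy0)
    have h1 := trace_orthogonal_mul_le (hmono hx) (hmono hy) (fun i => Real.sqrt_nonneg _)
      (fun i => Real.sqrt_nonneg _) hQ hV
    have h2 : wassersteinReal (diagonal x) (diagonal y) =
        ∑ i, x i + ∑ i, y i - 2 * ∑ i, √(y i) * √(x i) := by
      rw [wassersteinReal_diagonal hx0 hy0, Finset.sum_sub_distrib, Finset.sum_add_distrib,
        Finset.mul_sum]
      simp only [Real.sqrt_mul (hx0 _), mul_comm]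
    rw [wassersteinReal_eq (V * diagonal x * Vᵀ), h, sqrt_conj_diagonal hV hx0, sqrt_diagonal hy0,
      trace_conj_diagonal hV, trace_diagonal, h2]
    linarith
  refine isSpectralDivergence_of (P := PosSemidef) (Q := PosSemidef) (F := wassersteinReal)
    (q := fun a => 0 ≤ a) (r := fun b => 0 ≤ b) (f := fun a b => a + b - 2 * √(a * b))
    (fun _ _ => wassersteinDivergence_of_posSemidef) (fun _ _ h => if_neg h)
    (fun a b ha hb => if_pos ⟨ha, hb⟩) (fun a b h => if_neg h)
    (fun V hV X => posSemidef_conj_iff hV) (fun V hV X => posSemidef_conj_iff hV)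
    (fun x => posSemidef_diagonal) (fun x => posSemidef_diagonal) (fun V hV X Y hX hY => ?_)
    (fun a b ha hb => ?_) (fun x y => wassersteinReal_diagonal) (fun b hb => ?_)
    (fun x y hx hy hx0 hy0 V hV => ?_) (fun x y hx hy hx0 hy0 V hV h => ?_)
  · rw [wassersteinReal_eq, wassersteinReal_eq, sqrt_conj hV hX, conj_mul_conj hV,
      conj_mul_conj hV, sqrt_conj hV (sqrt_mul_mul_sqrt_posSemidef hY), trace_conj hV,
      trace_conj hV, trace_conj hV]
  · rw [Real.sqrt_mul ha]
    nlinarith [sq_nonneg (√a - √b), Real.sq_sqrt ha, Real.sq_sqrt hb]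
  -- Splitting the root also covers b = 0, where the chain rule for √(ab) would meet the root at 0.
  · have h : ContDiffOn ℝ 2 (fun a : ℝ => a + b - 2 * (√a * √b)) (Set.Ioi 0) :=
      (contDiffOn_id.add contDiffOn_const).sub (contDiffOn_const.mul
        ((contDiffOn_id.sqrt fun a ha => (Set.mem_Ioi.1 ha).ne').mul contDiffOn_const))
    exact h.congr fun a ha => by rw [Real.sqrt_mul (Set.mem_Ioi.1 ha).le]
  · have h1 := trace_diagonal_mul_conj_le (hmono hx) (hmono hy) hV
    have h2 := key x y hx hy hx0 hy0 V hV
    linarith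
  · have h1 := trace_diagonal_mul_conj_le (hmono hx) (hmono hy) hV
    have h2 := key x y hx hy hx0 hy0 V hV
    obtain ⟨W, hW, h3, h4⟩ :=
      (trace_diagonal_mul_conj_eq_iff (hmono hx) (hmono hy) hV).1 (by linarith)
    refine ⟨W, hW, ?_, ?_⟩
    -- The common basis was found for the roots; squaring returns to y here and to x below.
    · rw [← conj_diagonal_mul_self_eq hy0 hW, h3, diagonal_mul_diagonal]
      simp only [Real.mul_self_sqrt (hy0 _)]
    · rw [← conj_diagonal_mul_self_eq hx0 hV, h4, conj_diagonal_mul_self_eq hx0 hW]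

end Wasserstein

theorem mainTheorem9 (p : ℕ) :
    (IsConvexDivergence (klDivergence (p := p)) ∧
      IsSpectralDivergence (klDivergence (p := p)) klGenerator) ∧
    (IsConvexDivergence (wassersteinDivergence (p := p)) ∧
      IsSpectralDivergence (wassersteinDivergence (p := p)) wassersteinGenerator) ∧
    (IsConvexDivergence (steinDivergence (p := p)) ∧
      IsSpectralDivergence (steinDivergence (p := p)) steinGenerator) ∧
    (IsConvexDivergence (sqFrobeniusDivergence (p := p)) ∧
      IsSpectralDivergence (sqFrobeniusDivergence (p := p)) sqFrobeniusGenerator) ∧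
    (IsConvexDivergence (weightedFrobeniusDivergence (p := p)) ∧
      IsSpectralDivergence (weightedFrobeniusDivergence (p := p)) weightedFrobeniusGenerator) ∧
    -- for the two Frobenius divergences, smoothness holds up to the boundary of the domain
    (∀ S : Matrix (Fin p) (Fin p) ℝ, S.PosSemidef →
      DifferentiableOn ℝ (fun X => (sqFrobeniusDivergence X S).toReal) {X | X.PosSemidef}) ∧
    (∀ S : Matrix (Fin p) (Fin p) ℝ, S.PosDef →
      DifferentiableOn ℝ (fun X => (weightedFrobeniusDivergence X S).toReal) {X | X.PosSemidef}) ∧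
    (∀ b : ℝ, 0 ≤ b →
      ContDiffOn ℝ 2 (fun a => (sqFrobeniusGenerator a b).toReal) (Set.Ici 0)) ∧
    (∀ b : ℝ, 0 < b →
      ContDiffOn ℝ 2 (fun a => (weightedFrobeniusGenerator a b).toReal) (Set.Ici 0)) :=
  ⟨⟨isConvexDivergence_kl, isSpectralDivergence_kl⟩,
    ⟨isConvexDivergence_wasserstein, isSpectralDivergence_wasserstein⟩,
    ⟨isConvexDivergence_stein, isSpectralDivergence_stein⟩,
    ⟨isConvexDivergence_sqFrobenius, isSpectralDivergence_sqFrobenius⟩,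
    ⟨isConvexDivergence_weightedFrobenius, isSpectralDivergence_weightedFrobenius⟩,
    fun _ => differentiableOn_sqFrobenius, fun _ => differentiableOn_weightedFrobenius,
    fun _ => contDiffOn_sqFrobeniusGenerator, fun _ => contDiffOn_weightedFrobeniusGenerator⟩
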